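/- Let $n \ge 2$ be an integer and let $G$ be an abelian group with $G \simeq C_2 \oplus C_2 \oplus C_{2n}$, where $C_m$ denotes a cyclic group of order $m$; thus $\exp(G) = 2n$. A sequence over $G$ is a finite unordered sequence of elements of $G$ with repetition allowed, i.e. an element of the (multiplicatively written) free abelian monoid $\mathcal{F}(G)$ over $G$; its subsequences are its divisors, its length is the number of its terms counted with multiplicity, $\sigma(S)$ denotes the sum of its terms, $\operatorname{supp}(S)$ the set of its terms, and $h+S$ the sequence obtained by adding $h \in G$ to each term. A sequence is zero-sum if its sum is $0$. Let $\mathsf{s}(G)$ be the smallest $\ell$ such that every sequence over $G$ of length at least $\ell$ has a zero-sum subsequence of length $\exp(G)$. A basis of $G$ is an independent generating set, where $f_1,f_2,f_3$ are independent if $a_1f_1+a_2f_2+a_3f_3=0$ with integers $a_i$ implies $a_if_i=0$ for each $i$. Intervals $[x,y]$ are intervals of integers. Then $\mathsf{s}(G) - 1 = 4n+2$, and a sequence $S$ over $G$ of length $|S| = \mathsf{s}(G)-1 = 4n+2$ contains no zero-sum subsequence of length $\exp(G) = 2n$ if and only if there exist a basis $\{f_1,f_2,f_3\}$ of $G$,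 where $\operatorname{ord}(f_1)=\operatorname{ord}(f_2)=2$ and $\operatorname{ord}(f_3)=2n$, and an $f \in G$ such that $-f+S$ is equal to one of the following sequences: (s1) $0^{2\alpha+1} f_2^{2n-2\alpha-1} f_3^{2n-1-2\beta} (f_3+f_2)^{2\beta+1} (af_3+f_1)\bigl((1-a)f_3+f_2+f_1\bigr)$ with $a \in [2,n-1]$ and $\alpha,\beta \in [0,n-1]$; (s2) $0^{2n-1} f_3^{2n-1} (af_3+f_2)\bigl((1-a)f_3+f_2\bigr)(bf_3+f_1)\bigl((1-b)f_3+f_1\bigr)$ with $a,b \in [2,n-1]$ and $a \ge b$; (s3) $0^{2\alpha+1} f_1^{2\beta+1} f_2^{2\gamma+1} \prod_{i=1}^{2n+1}(f_3+d_i)$, where $\alpha,\beta,\gamma \in [0,n-1]$ are such that $\alpha+\beta+\gamma = n-1$, and $S' = \prod_{i=1}^{2n+1} d_i$ is a sequence over $\langle f_1,f_2\rangle$ with $\sigma(S') \notin \operatorname{supp}(S')$. -/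

import Mathlib

/-!
Let `π : G → C₂³` be a homomorphism whose kernel is cyclic of order `n`. Pair off terms of `S` lying
in a common fibre of `π` until one term `s v` is left in each fibre over a set `W`. The sum of a
pair lies in `ker π`, and so does the sum of the four terms over an affine plane contained in `W`.
If `S` has no zero-sum subsequence of length `2n`, then no `n` pair sums add up to `0`, and no
`n - 2` pair sums cancel the sum over a plane. By the inverse of the Erdős–Ginzburg–Ziv theorem at
most one value is missed by the sums of `n - 2` out of `2n - 3` elements of a cyclic group of order
`n`, hence all planes in `W` have the same sum. Exchanging a term `s v` with a paired term of its
fibre does not change this common sum, so all terms in that fibre coincide.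

This rigidity gives `|S| ≤ 4n + 2`. In case of equality `W` consists of three parallel lines, and
the pair sums form a sequence `a^(n-1) b^(n-1)` where `b - a` generates `ker π`. After a translation
the terms of `S` lie on `{0, f}`, `{e₁, f - e₁}` and `{e₂, f - e₂}`, and the three forms arise
according to which of `2 e₁` and `2 e₂` lie in `{0, 2 f}`.
-/

namespace EGZ

section Sequences

variable {G : Type*} [AddCommGroup G]

/-- A sequence over `G` (an element of the free abelian monoid over `G`) is a multiset of elements
of `G`; the product of sequences is the sum of multisets and a subsequence is a submultiset.
`subsums L S` is the set `Σ_L(S)` of the sums of the nonempty subsequences of `S` whose length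
lies in `L`. -/
def subsums (L : Set ℕ) (S : Multiset G) : Set G :=
  {x | ∃ T : Multiset G, T ≤ S ∧ T ≠ 0 ∧ T.card ∈ L ∧ T.sum = x}

variable (G) in
/-- `s_L(G)`: the smallest `ℓ` such that every sequence over `G` of length at least `ℓ` has a
nonempty zero-sum subsequence with length in `L`; it is `⊤` when there is no such `ℓ`. -/
noncomputable def zeroSumConstant (L : Set ℕ) : ℕ∞ :=
  sInf ((fun ℓ : ℕ => (ℓ : ℕ∞)) ''
    {ℓ : ℕ | ∀ S : Multiset G, ℓ ≤ S.card → (0 : G) ∈ subsums L S})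

variable (G) in
/-- The Erdős–Ginzburg–Ziv constant `s(G)`. -/
noncomputable def egzConstant : ℕ∞ :=
  zeroSumConstant G {AddMonoid.exponent G}

/-- The translate `h + S`. -/
def translate (h : G) (S : Multiset G) : Multiset G :=
  S.map (fun g => h + g)

/-- `f₁, f₂, f₃` are independent: `a₁ f₁ + a₂ f₂ + a₃ f₃ = 0` with integers `aᵢ` implies that
every `aᵢ fᵢ` is `0`. -/
def Independent (f₁ f₂ f₃ : G) : Prop :=
  ∀ a₁ a₂ a₃ : ℤ, a₁ • f₁ + a₂ • f₂ + a₃ • f₃ = 0 →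
    a₁ • f₁ = 0 ∧ a₂ • f₂ = 0 ∧ a₃ • f₃ = 0

/-- `f₁, f₂, f₃` form a basis of `G` (an independent generating set) and have orders
`2, 2, 2n`. -/
def IsBasis (n : ℕ) (f₁ f₂ f₃ : G) : Prop :=
  Independent f₁ f₂ f₃ ∧ AddSubgroup.closure {f₁, f₂, f₃} = (⊤ : AddSubgroup G) ∧
    addOrderOf f₁ = 2 ∧ addOrderOf f₂ = 2 ∧ addOrderOf f₃ = 2 * n

/-- The form
`0^(2α+1) f₂^(2n-2α-1) f₃^(2n-1-2β) (f₃+f₂)^(2β+1) (a f₃+f₁) ((1-a) f₃+f₂+f₁)`. The natural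
number subtractions do not truncate, as `α, β ≤ n - 1` and `1 ≤ n` where the form is used. -/
def FormS1 (n : ℕ) (f₁ f₂ f₃ : G) (T : Multiset G) : Prop :=
  ∃ α β : ℕ, ∃ a : ℤ, α ≤ n - 1 ∧ β ≤ n - 1 ∧ 2 ≤ a ∧ a ≤ (n : ℤ) - 1 ∧
    T = Multiset.replicate (2 * α + 1) 0 + Multiset.replicate (2 * n - 2 * α - 1) f₂
      + Multiset.replicate (2 * n - 1 - 2 * β) f₃ + Multiset.replicate (2 * β + 1) (f₃ + f₂)
      + {a • f₃ + f₁} + {(1 - a) • f₃ + f₂ + f₁}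

/-- The form `0^(2n-1) f₃^(2n-1) (a f₃+f₂) ((1-a) f₃+f₂) (b f₃+f₁) ((1-b) f₃+f₁)`. -/
def FormS2 (n : ℕ) (f₁ f₂ f₃ : G) (T : Multiset G) : Prop :=
  ∃ a b : ℤ, 2 ≤ a ∧ a ≤ (n : ℤ) - 1 ∧ 2 ≤ b ∧ b ≤ (n : ℤ) - 1 ∧ b ≤ a ∧
    T = Multiset.replicate (2 * n - 1) 0 + Multiset.replicate (2 * n - 1) f₃
      + {a • f₃ + f₂} + {(1 - a) • f₃ + f₂} + {b • f₃ + f₁} + {(1 - b) • f₃ + f₁}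

/-- The form `0^(2α+1) f₁^(2β+1) f₂^(2γ+1) ∏ (f₃ + dᵢ)`, where `D = ∏ dᵢ` is a sequence of length
`2n+1` over `⟨f₁, f₂⟩` whose sum is not one of its terms. -/
def FormS3 (n : ℕ) (f₁ f₂ f₃ : G) (T : Multiset G) : Prop :=
  ∃ α β γ : ℕ, ∃ D : Multiset G, α ≤ n - 1 ∧ β ≤ n - 1 ∧ γ ≤ n - 1 ∧ α + β + γ = n - 1 ∧
    D.card = 2 * n + 1 ∧ (∀ d ∈ D, d ∈ AddSubgroup.closure {f₁, f₂}) ∧ D.sum ∉ D ∧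
    T = Multiset.replicate (2 * α + 1) 0 + Multiset.replicate (2 * β + 1) f₁
      + Multiset.replicate (2 * γ + 1) f₂ + D.map (fun d => f₃ + d)

end Sequences

end EGZ

namespace EGZ

section Dedup

variable {A : Type*}

theorem sub_dedup_add_dedup [DecidableEq A] (W : Multiset A) : W - W.dedup + W.dedup = W :=
  tsub_add_cancel_of_le (Multiset.dedup_le W)

theorem count_sub_dedup_le [DecidableEq A] {W : Multiset A} {k : ℕ}
    (h : ∀ a, W.count a ≤ k + 1) (a : A) :
    (W - W.dedup).count a ≤ k := by
  have := h a
  rw [Multiset.count_sub, Multiset.count_dedup]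
  split_ifs with ha
  · omega
  · rw [Multiset.count_eq_zero_of_notMem ha, Nat.zero_sub]
    exact k.zero_le

theorem pair_le_val {K : Finset A} {x y : A} (hx : x ∈ K) (hy : y ∈ K) (hxy : x ≠ y) :
    ({x, y} : Multiset A) ≤ K.val :=
  (Multiset.le_iff_subset (by simpa using hxy)).2 (by simp [Multiset.subset_iff, hx, hy])

end Dedup

section ShortSums

open Finset
open scoped Pointwise

variable {A : Type*} [AddCommGroup A] [DecidableEq A]

/-- The Kemperman–Scherk theorem. -/
theorem card_add_card_le_of_unique_zero (X Y : Finset A) (hX : (0 : A) ∈ X) (hY : (0 : A) ∈ Y)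
    (h : ∀ x ∈ X, ∀ y ∈ Y, x + y = 0 → y = 0) : #X + #Y ≤ #(X + Y) + 1 := by
  induction hk : #Y using Nat.strong_induction_on generalizing X Y with
  | _ k ih =>
  by_cases hc : ∀ e ∈ X, e +ᵥ Y ⊆ X
  · have hY0 : Y ⊆ {0} := fun y hy => by
      have himage : X.image (· + y) = X := by
        refine eq_of_subset_of_card_le (image_subset_iff.2 fun e he => ?_)
          (card_image_of_injective X (add_left_injective y)).ge
        exact hc e he (vadd_mem_vadd_finset hy)
      obtain ⟨e, he, hey⟩ := mem_image.1 (himage.symm ▸ hX)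
      exact mem_singleton.2 (h e he y hy hey)
    have := card_le_card hY0
    have := card_le_card (subset_add_left X hY)
    rw [card_singleton] at *
    omega
  · push Not at hc
    obtain ⟨e, he, heY⟩ := hc
    obtain ⟨z, hz, hzX⟩ := not_subset.1 heY
    obtain ⟨y, hy, rfl⟩ := mem_vadd_finset.1 hz
    have hmem {w : A} : w ∈ Y ∩ (-e +ᵥ X) ↔ w ∈ Y ∧ e + w ∈ X := by
      rw [mem_inter, mem_neg_vadd_finset_iff, vadd_eq_add]
    have hlt : #(Y ∩ (-e +ᵥ X)) < #Y :=
      card_lt_card ⟨inter_subset_left, fun hsub => hzX (hmem.1 (hsub hy)).2⟩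
    have hcard : #(X ∪ (e +ᵥ Y)) + #(Y ∩ (-e +ᵥ X)) = #X + #Y :=
      addDysonETransform.card e (X, Y)
    have hle : #((X ∪ (e +ᵥ Y)) + Y ∩ (-e +ᵥ X)) ≤ #(X + Y) :=
      card_le_card (addDysonETransform.subset e (X, Y))
    have hunique : ∀ x ∈ X ∪ (e +ᵥ Y), ∀ w ∈ Y ∩ (-e +ᵥ X), x + w = 0 → w = 0 := by
      intro x hx w hw hxw
      obtain ⟨hwY, hwX⟩ := hmem.1 hw
      rcases mem_union.1 hx with hx | hx
      · exact h x hx w hwY hxw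
      · obtain ⟨b, hb, rfl⟩ := mem_vadd_finset.1 hx
        rw [vadd_eq_add] at hxw
        obtain rfl : b = 0 := h (e + w) hwX b hb (by rw [← hxw]; abel)
        exact h e he w hwY (by rwa [add_zero] at hxw)
    have := ih _ (hk ▸ hlt) _ _ (mem_union_left _ hX) (hmem.2 ⟨hY, by rwa [add_zero]⟩) hunique rfl
    omega

/-- The sums of the subsequences of `W` of length at most `k`, the empty one included. -/
def shortSums (k : ℕ) (W : Multiset A) : Finset A :=
  ((W.powerset.filter (Multiset.card · ≤ k)).map Multiset.sum).toFinset

theorem mem_shortSums {k : ℕ} {W : Multiset A} {x : A} :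
    x ∈ shortSums k W ↔ ∃ Z ≤ W, Z.card ≤ k ∧ Z.sum = x := by
  simp [shortSums, and_assoc]

theorem zero_mem_shortSums (k : ℕ) (W : Multiset A) : 0 ∈ shortSums k W :=
  mem_shortSums.2 ⟨0, zero_le, by simp, by simp⟩

end ShortSums

/-- `W` has no nonempty zero-sum subsequence of length at most `k`. -/
def ShortZeroSumFree {A : Type*} [AddCommMonoid A] (k : ℕ) (W : Multiset A) : Prop :=
  ∀ Z ≤ W, Z.card ≤ k → Z.sum = 0 → Z = 0

section ShortZeroSumFree

open Finset
open scoped Pointwise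

variable {A : Type*} [AddCommGroup A]

theorem ShortZeroSumFree.mono {k l : ℕ} {U W : Multiset A} (h : ShortZeroSumFree l W)
    (hkl : k ≤ l) (hUW : U ≤ W) : ShortZeroSumFree k U :=
  fun Z hZ hZk => h Z (hZ.trans hUW) (hZk.trans hkl)

theorem ShortZeroSumFree.zero_notMem {k : ℕ} {W : Multiset A} (h : ShortZeroSumFree (k + 1) W) :
    (0 : A) ∉ W := fun h0 =>
  Multiset.singleton_ne_zero 0 (h {0} (Multiset.singleton_le.2 h0) (by simp) (by simp))

theorem sub_mem_of_add_mem {K : Finset A} (h0 : (0 : A) ∉ K)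
    (hK : ∀ x ∈ K, ∀ y ∈ K, x ≠ y → x + y ∈ K) {x y : A} (hx : x ∈ K) (hy : y ∈ K) (hyx : y ≠ x) :
    y - x ∈ K := by
  classical
  have himage : (K.erase x).image (· + x) = K.erase x := by
    refine eq_of_subset_of_card_le (image_subset_iff.2 fun w hw => ?_)
      (card_image_of_injective _ (add_left_injective x)).ge
    obtain ⟨hwx, hw⟩ := mem_erase.1 hw
    exact mem_erase.2 ⟨fun hw0 => h0 (add_eq_right.1 hw0 ▸ hw), hK w hw x hx hwx⟩
  obtain ⟨w, hw, rfl⟩ := mem_image.1 (himage.symm ▸ mem_erase.2 ⟨hyx, hy⟩)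
  rw [add_sub_cancel_right]
  exact mem_of_mem_erase hw

theorem neg_mem_of_add_mem {K : Finset A} (h0 : (0 : A) ∉ K)
    (hK : ∀ x ∈ K, ∀ y ∈ K, x ≠ y → x + y ∈ K) {g h : A} (hg : g ∈ K) (hh : h ∈ K) (hgh : g ≠ h) :
    -g ∈ K := by
  have hsub : h - g ∈ K := sub_mem_of_add_mem h0 hK hg hh hgh.symm
  have hg0 : g ≠ 0 := fun hg0 => h0 (hg0 ▸ hg)
  simpa using sub_mem_of_add_mem h0 hK hh hsub (by simpa using hg0)

variable [DecidableEq A]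

theorem card_shortSums_add_le {k l : ℕ} {U W : Multiset A} (h : ShortZeroSumFree (k + l) (U + W)) :
    #(shortSums k U) + #(shortSums l W) ≤ #(shortSums (k + l) (U + W)) + 1 := by
  refine (card_add_card_le_of_unique_zero _ _ (zero_mem_shortSums k U) (zero_mem_shortSums l W)
    fun x hx y hy hxy => ?_).trans (Nat.succ_le_succ (card_le_card fun z hz => ?_))
  · obtain ⟨Z, hZ, hZk, rfl⟩ := mem_shortSums.1 hx
    obtain ⟨Z', hZ', hZl, rfl⟩ := mem_shortSums.1 hy
    have := h (Z + Z') (add_le_add hZ hZ') (by rw [Multiset.card_add]; omega)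
      (by rwa [Multiset.sum_add])
    rw [(add_eq_zero.1 this).2, Multiset.sum_zero]
  · obtain ⟨x, hx, y, hy, rfl⟩ := mem_add.1 hz
    obtain ⟨Z, hZ, hZk, rfl⟩ := mem_shortSums.1 hx
    obtain ⟨Z', hZ', hZl, rfl⟩ := mem_shortSums.1 hy
    exact mem_shortSums.2 ⟨Z + Z', add_le_add hZ hZ', by rw [Multiset.card_add]; omega,
      Multiset.sum_add _ _⟩

theorem card_lt_card_shortSums {k : ℕ} {W : Multiset A} (hcount : ∀ a, W.count a ≤ k)
    (h : ShortZeroSumFree k W) : W.card < #(shortSums k W) := by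
  induction k generalizing W with
  | zero =>
    obtain rfl : W = 0 := Multiset.eq_zero_of_forall_notMem fun a ha =>
      (hcount a).not_gt (Multiset.count_pos.2 ha)
    exact card_pos.2 ⟨0, zero_mem_shortSums 0 0⟩
  | succ k ih =>
    have hrest := ih (count_sub_dedup_le hcount) (h.mono k.le_succ tsub_le_self)
    have hdedup : W.dedup.card + 1 ≤ #(shortSums 1 W.dedup) := by
      rw [← W.toFinset_val, card_val, ← card_insert_of_notMem (by simpa using h.zero_notMem)]
      refine card_le_card (insert_subset (zero_mem_shortSums _ _) fun a ha => ?_)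
      exact mem_shortSums.2 ⟨{a}, Multiset.singleton_le.2 ha, by simp, by simp⟩
    have hadd := card_shortSums_add_le (k := k) (l := 1) ((sub_dedup_add_dedup W).symm ▸ h)
    have hcard := congrArg Multiset.card (sub_dedup_add_dedup W)
    rw [sub_dedup_add_dedup] at hadd
    rw [Multiset.card_add] at hcard
    omega

theorem card_add_two_le_card_shortSums_two {K : Finset A} (h : ShortZeroSumFree 2 K.val)
    {g g' : A} (hg : g ∈ K) (hg' : g' ∈ K) (hne : g ≠ g') (hg2 : g + g ≠ 0) :
    #K + 2 ≤ #(shortSums 2 K.val) := by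
  have h0 : (0 : A) ∉ K := h.zero_notMem
  have hadd : ∀ x ∈ K, ∀ y ∈ K, x ≠ y → x + y ≠ 0 := fun x hx y hy hxy hs => by
    simpa using h {x, y} (pair_le_val hx hy hxy) (by simp) (by simpa using hs)
  obtain ⟨x, hx, y, hy, hxy, hnew⟩ : ∃ x ∈ K, ∃ y ∈ K, x ≠ y ∧ x + y ∉ K := by
    by_contra! hclosed
    refine hadd g hg (-g) (neg_mem_of_add_mem h0 hclosed hg hg' hne) (fun hneg => hg2 ?_) (by simp)
    rwa [eq_neg_iff_add_eq_zero] at hneg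
  have hinsert : #(insert (x + y) (insert 0 K)) = #K + 2 := by
    rw [card_insert_of_notMem (by simp [hadd x hx y hy hxy, hnew]), card_insert_of_notMem h0]
  rw [← hinsert]
  refine card_le_card (insert_subset ?_ (insert_subset (zero_mem_shortSums _ _) fun a ha => ?_))
  · exact mem_shortSums.2 ⟨{x, y}, pair_le_val hx hy hxy, by simp, by simp⟩
  · exact mem_shortSums.2 ⟨{a}, Multiset.singleton_le.2 ha, by simp, by simp⟩

theorem card_add_two_le_card_shortSums {k : ℕ} {W : Multiset A} (hcount : ∀ a, W.count a ≤ k + 1)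
    (h : ShortZeroSumFree (k + 2) W) {g g' : A} (hg : g ∈ W) (hg' : g' ∈ W) (hne : g ≠ g')
    (hg2 : g + g ≠ 0) : W.card + 2 ≤ #(shortSums (k + 2) W) := by
  have hrest := card_lt_card_shortSums (count_sub_dedup_le hcount)
    (h.mono (by omega) tsub_le_self)
  have hdedup := card_add_two_le_card_shortSums_two (K := W.toFinset)
    (h.mono (by omega) (Multiset.dedup_le W)) (by simpa using hg) (by simpa using hg') hne hg2
  have hadd := card_shortSums_add_le (k := k) (l := 2) ((sub_dedup_add_dedup W).symm ▸ h)
  have hcard := congrArg Multiset.card (sub_dedup_add_dedup W)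
  rw [sub_dedup_add_dedup] at hadd
  rw [Multiset.card_add] at hcard
  rw [← card_val, W.toFinset_val] at hdedup
  omega

end ShortZeroSumFree

/-- `x` is not the sum of a subsequence of `S` of length `ℓ`. -/
def AvoidsSum {A : Type*} [AddCommMonoid A] (ℓ : ℕ) (x : A) (S : Multiset A) : Prop :=
  ∀ Z ≤ S, Z.card = ℓ → Z.sum ≠ x

section AvoidsSum

variable {A : Type*} [AddCommGroup A] {ℓ : ℕ} {x : A} {S T : Multiset A}

theorem AvoidsSum.mono (h : AvoidsSum ℓ x S) (hTS : T ≤ S) : AvoidsSum ℓ x T :=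
  fun Z hZ => h Z (hZ.trans hTS)

theorem AvoidsSum.compl (h : AvoidsSum ℓ x S) {m : ℕ} (hm : ℓ + m = S.card) :
    AvoidsSum m (S.sum - x) S := by
  classical
  intro Z hZ hZm hZx
  have hsplit : S - Z + Z = S := tsub_add_cancel_of_le hZ
  have hcard := congrArg Multiset.card hsplit
  have hsum := congrArg Multiset.sum hsplit
  rw [Multiset.card_add] at hcard
  rw [Multiset.sum_add] at hsum
  exact h (S - Z) tsub_le_self (by omega) (by rwa [hZx, add_sub_left_comm, add_eq_left,
    sub_eq_zero] at hsum)

theorem AvoidsSum.cons {y : A} (h : AvoidsSum (ℓ + 1) x S) (hy : AvoidsSum ℓ (x - y) S) :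
    AvoidsSum (ℓ + 1) x (y ::ₘ S) := by
  intro Z hZ hZℓ hZx
  by_cases hyZ : y ∈ Z
  · obtain ⟨Z, rfl⟩ := Multiset.exists_cons_of_mem hyZ
    rw [Multiset.sum_cons] at hZx
    exact hy Z ((Multiset.cons_le_cons_iff _).1 hZ) (by simpa using hZℓ)
      (eq_sub_of_add_eq' hZx)
  · exact h Z ((Multiset.le_cons_of_notMem hyZ).1 hZ) hZℓ hZx

theorem translate_neg_translate (h : A) (S : Multiset A) : translate (-h) (translate h S) = S := by
  simp [translate]

theorem sum_translate (h : A) (S : Multiset A) :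
    (translate h S).sum = S.card • h + S.sum := by
  rw [translate, Multiset.sum_map_add, Multiset.map_const', Multiset.sum_replicate,
    Multiset.map_id']

protected theorem AvoidsSum.translate {h : A} (hS : AvoidsSum ℓ 0 S) (hh : ℓ • h = 0) :
    AvoidsSum ℓ 0 (translate h S) := by
  intro Z hZ hZℓ hZx
  refine hS (translate (-h) Z) ?_ (by simpa [translate] using hZℓ) ?_
  · rw [← translate_neg_translate h S]
    exact Multiset.map_le_map hZ
  · rw [sum_translate, hZℓ, smul_neg, hh, hZx, neg_zero, add_zero]

end AvoidsSum

section Cyclic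

variable {A : Type*} [AddCommGroup A]

theorem exists_sub_shortZeroSumFree [DecidableEq A] (W : Multiset A) (n : ℕ) :
    ∃ Z ≤ W, Z.card ≤ n ∧ Z.sum = 0 ∧ ShortZeroSumFree (n - Z.card) (W - Z) := by
  obtain ⟨Z, hZ, hmax⟩ := Finset.exists_max_image
    (W.powerset.toFinset.filter fun Z => Z.card ≤ n ∧ Z.sum = 0) Multiset.card ⟨0, by simp⟩
  simp only [Finset.mem_filter, Multiset.mem_toFinset, Multiset.mem_powerset] at hZ hmax
  obtain ⟨hZW, hZn, hZ0⟩ := hZ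
  refine ⟨Z, hZW, hZn, hZ0, fun Y hY hYn hY0 => ?_⟩
  have hYZ : Y + Z ≤ W :=
    (Multiset.add_le_add_right hY).trans (tsub_add_cancel_of_le hZW).le
  have hcard := hmax (Y + Z) ⟨hYZ, by rw [Multiset.card_add]; omega, by simp [hY0, hZ0]⟩
  rw [Multiset.card_add] at hcard
  exact Multiset.card_eq_zero.1 (by omega)

theorem exists_zero_sum_of_le_card [IsAddCyclic A] {T : Multiset A}
    (hT : 2 * Nat.card A - 1 ≤ T.card) :
    ∃ Z ≤ T, Z.card = Nat.card A ∧ Z.sum = 0 := by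
  let e : ZMod (Nat.card A) ≃+ A := zmodAddCyclicAddEquiv inferInstance
  obtain ⟨Z, hZ, hZc, hZs⟩ := ZMod.erdos_ginzburg_ziv_multiset (T.map e.symm) (by simpa using hT)
  refine ⟨Z.map e, ?_, by simpa using hZc, ?_⟩
  · simpa using Multiset.map_le_map (f := e) hZ
  · rw [← map_multiset_sum, hZs, map_zero]

variable [Finite A]

theorem card_lt_of_shortZeroSumFree {k : ℕ} {W : Multiset A} [DecidableEq A]
    (hcount : ∀ a, W.count a ≤ k) (h : ShortZeroSumFree k W) : W.card < Nat.card A := by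
  have : Fintype A := Fintype.ofFinite A
  rw [Nat.card_eq_fintype_card]
  exact (card_lt_card_shortSums hcount h).trans_le (Finset.card_le_univ _)

theorem addOrderOf_eq_card_of_shortZeroSumFree {g : A}
    (h : ShortZeroSumFree (Nat.card A - 1) (Multiset.replicate (Nat.card A - 1) g)) :
    addOrderOf g = Nat.card A := by
  have hpos : 0 < addOrderOf g := addOrderOf_pos g
  refine le_antisymm (Nat.le_of_dvd Nat.card_pos (addOrderOf_dvd_natCard g)) ?_
  by_contra! hlt
  have hzero := h (Multiset.replicate (addOrderOf g) g)
    ((Multiset.replicate_le_replicate g).2 (by omega))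
    (by rw [Multiset.card_replicate]; omega)
    (by rw [Multiset.sum_replicate, addOrderOf_nsmul_eq_zero])
  have := congrArg Multiset.card hzero
  rw [Multiset.card_replicate, Multiset.card_zero] at this
  omega

variable [IsAddCyclic A]

theorem eq_of_add_self_eq_zero {x y : A} (hx : x ≠ 0) (hy : y ≠ 0)
    (hx2 : x + x = 0) (hy2 : y + y = 0) : x = y := by
  classical
  have : Fintype A := Fintype.ofFinite A
  by_contra hxy
  have htorsion := IsAddCyclic.card_nsmul_eq_zero_le (α := A) (n := 2) two_pos
  have hsub : ({0, x, y} : Finset A) ⊆ Finset.univ.filter (fun a : A => 2 • a = 0) := by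
    intro z hz
    simp only [Finset.mem_insert, Finset.mem_singleton] at hz
    rcases hz with rfl | rfl | rfl <;> simp [two_nsmul, *]
  have hcard := Finset.card_le_card hsub
  rw [Finset.card_insert_of_notMem (by simp [hx.symm, hy.symm]), Finset.card_pair hxy] at hcard
  omega

theorem eq_replicate_of_shortZeroSumFree [DecidableEq A] {k : ℕ} {W : Multiset A}
    (hcard : Nat.card A ≤ W.card + 1) (hcount : ∀ a, W.count a ≤ k + 1)
    (h : ShortZeroSumFree (k + 2) W) {g : A} (hg : g ∈ W) : W = Multiset.replicate W.card g := by
  refine Multiset.eq_replicate_card.2 fun x hx => ?_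
  by_contra hxg
  have hne {z : A} (hz : z ∈ W) : z ≠ 0 := ne_of_mem_of_not_mem hz h.zero_notMem
  have : Fintype A := Fintype.ofFinite A
  have hle := Finset.card_le_univ (shortSums (k + 2) W)
  rw [← Nat.card_eq_fintype_card] at hle
  by_cases hx2 : x + x = 0
  · have hg2 : g + g ≠ 0 := fun hg2 => hxg (eq_of_add_self_eq_zero (hne hx) (hne hg) hx2 hg2)
    have := card_add_two_le_card_shortSums hcount h hg hx (Ne.symm hxg) hg2
    omega
  · have := card_add_two_le_card_shortSums hcount h hx hg hxg hx2
    omega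

theorem AvoidsSum.eq_replicate_of_count_le [DecidableEq A] (hA : 2 ≤ Nat.card A) {T : Multiset A}
    (hT : T.card = 2 * Nat.card A - 2) (hmax : ∀ a, T.count a ≤ T.count 0) (h0 : 0 ∈ T)
    (hZ : AvoidsSum (Nat.card A) 0 T) :
    ∃ g, addOrderOf g = Nat.card A ∧
      T = Multiset.replicate (Nat.card A - 1) 0 + Multiset.replicate (Nat.card A - 1) g := by
  set n := Nat.card A with hn
  set h := T.count 0 with hh
  have hpos : 1 ≤ h := Multiset.count_pos.2 h0
  set W := T.filter (· ≠ 0)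
  have hTW : Multiset.replicate h 0 + W = T := by
    rw [hh, ← Multiset.filter_eq']
    exact Multiset.filter_add_not _ T
  have hcard : h + W.card = 2 * n - 2 := by
    rw [← hT, ← hTW, Multiset.card_add, Multiset.card_replicate]
  obtain ⟨Z, hZW, hZn, hZ0, hfree⟩ := exists_sub_shortZeroSumFree W n
  have hWZ : (W - Z).card + Z.card = W.card := by
    rw [← Multiset.card_add, tsub_add_cancel_of_le hZW]
  -- otherwise `Z` could be filled up with zeros
  have hlt : Z.card + h < n := by
    by_contra! hle
    refine hZ (Multiset.replicate (n - Z.card) 0 + Z) ?_ (by simp; omega) (by simp [hZ0])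
    rw [← hTW]
    exact add_le_add ((Multiset.replicate_le_replicate 0).2 (by omega)) hZW
  have hcount (a : A) : (W - Z).count a ≤ h :=
    (Multiset.count_le_of_le a (tsub_le_self.trans (Multiset.filter_le _ T))).trans (hmax a)
  have hupper : (W - Z).card < n :=
    card_lt_of_shortZeroSumFree hcount (hfree.mono (by omega) le_rfl)
  obtain ⟨g, hg⟩ : ∃ g, g ∈ W - Z := Multiset.card_pos_iff_exists_mem.1 (by omega)
  obtain ⟨k, hk⟩ : ∃ k, h = k + 1 := ⟨h - 1, by omega⟩
  have hrep := eq_replicate_of_shortZeroSumFree (k := k) (by omega)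
    (fun a => (hcount a).trans hk.le) (hfree.mono (by omega) le_rfl) hg
  rw [show (W - Z).card = n - 1 by omega] at hrep
  have hh' : n - 1 ≤ h := by simpa [hrep] using hcount g
  obtain rfl : Z = 0 := Multiset.card_eq_zero.1 (by omega)
  rw [tsub_zero] at hrep hfree
  refine ⟨g, addOrderOf_eq_card_of_shortZeroSumFree ?_, ?_⟩
  · rw [← hn, ← hrep]
    exact hfree.mono (by omega) le_rfl
  · rw [← hTW, ← hrep, show h = n - 1 by omega]

/-- The inverse theorem to the Erdős–Ginzburg–Ziv theorem for cyclic groups. -/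
theorem AvoidsSum.eq_replicate_add_replicate (hA : 2 ≤ Nat.card A) {T : Multiset A}
    (hT : T.card = 2 * Nat.card A - 2) (hZ : AvoidsSum (Nat.card A) 0 T) :
    ∃ a b, addOrderOf (b - a) = Nat.card A ∧
      T = Multiset.replicate (Nat.card A - 1) a + Multiset.replicate (Nat.card A - 1) b := by
  classical
  obtain ⟨x, hx⟩ : ∃ x, x ∈ T := Multiset.card_pos_iff_exists_mem.1 (by omega)
  obtain ⟨a, ha, hmax⟩ := Finset.exists_max_image T.toFinset T.count ⟨x, Multiset.mem_toFinset.2 hx⟩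
  rw [Multiset.mem_toFinset] at ha
  have hcount (b : A) : (translate (-a) T).count b = T.count (a + b) := by
    simpa [translate] using Multiset.count_map_eq_count' (-a + ·) T (add_right_injective _) (a + b)
  obtain ⟨g, hg, hgT⟩ := AvoidsSum.eq_replicate_of_count_le hA (T := translate (-a) T)
    (by simpa [translate] using hT)
    (fun b => by
      rw [hcount, hcount, add_zero]
      by_cases hb : a + b ∈ T
      · exact hmax _ (Multiset.mem_toFinset.2 hb)
      · simp [hb])
    (by rwa [← Multiset.count_pos, hcount, add_zero, Multiset.count_pos])
    (hZ.translate (by rw [smul_neg, card_nsmul_eq_zero', neg_zero]))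
  refine ⟨a, a + g, by rwa [add_sub_cancel_left], ?_⟩
  rw [← translate_neg_translate (-a) T, hgT, neg_neg]
  simp [translate]

theorem AvoidsSum.exists_cons_eq_replicate_add_replicate (hA : 2 ≤ Nat.card A) {T : Multiset A}
    (hT : T.card = 2 * Nat.card A - 3) (hZ : AvoidsSum (Nat.card A) 0 T) {x : A}
    (hx : AvoidsSum (Nat.card A - 2) x T) :
    ∃ a b, a ≠ b ∧ (x - T.sum) ::ₘ T =
      Multiset.replicate (Nat.card A - 1) a + Multiset.replicate (Nat.card A - 1) b := by
  have hcompl : AvoidsSum (Nat.card A - 1) (0 - (x - T.sum)) T := by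
    rw [zero_sub, neg_sub]
    exact hx.compl (by omega)
  have hcons : AvoidsSum (Nat.card A) 0 ((x - T.sum) ::ₘ T) := by
    rw [← Nat.sub_add_cancel (by omega : 1 ≤ Nat.card A)] at hZ ⊢
    exact hZ.cons hcompl
  obtain ⟨a, b, hab, hrep⟩ := hcons.eq_replicate_add_replicate hA
    (by rw [Multiset.card_cons, hT]; omega)
  refine ⟨a, b, fun h => ?_, hrep⟩
  rw [h, sub_self, addOrderOf_zero] at hab
  omega

theorem AvoidsSum.unique (hA : 2 ≤ Nat.card A) {T : Multiset A} (hT : T.card = 2 * Nat.card A - 3)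
    (hZ : AvoidsSum (Nat.card A) 0 T) {x y : A} (hx : AvoidsSum (Nat.card A - 2) x T)
    (hy : AvoidsSum (Nat.card A - 2) y T) : x = y := by
  classical
  rcases hA.eq_or_lt with hA2 | hA2
  · have htorsion (z : A) : z + z = 0 := by rw [← two_nsmul, hA2, card_nsmul_eq_zero']
    have hne {z : A} (hz : AvoidsSum (Nat.card A - 2) z T) : z ≠ 0 :=
      (hz 0 zero_le (by rw [← hA2, Multiset.card_zero])).symm
    exact eq_of_add_self_eq_zero (hne hx) (hne hy) (htorsion x) (htorsion y)
  · obtain ⟨a, b, hab, hxT⟩ := hZ.exists_cons_eq_replicate_add_replicate hA hT hx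
    obtain ⟨c, d, hcd, hyT⟩ := hZ.exists_cons_eq_replicate_add_replicate hA hT hy
    by_contra hxy
    have hne : x - T.sum ≠ y - T.sum := fun h => hxy (sub_left_injective h)
    -- the multiplicity of the new term would be `n - 2` in `T`, which is neither `0` nor `n - 1`
    have hcount := congrArg (Multiset.count (x - T.sum)) hxT
    have hcount' := congrArg (Multiset.count (x - T.sum)) hyT
    simp only [Multiset.count_cons_self, Multiset.count_cons_of_ne hne, Multiset.count_add,
      Multiset.count_replicate] at hcount hcount'
    grind

theorem AvoidsSum.eq_replicate_and_eq_neg_add (hA : 2 ≤ Nat.card A) {T : Multiset A}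
    (hT : T.card = 2 * Nat.card A - 2) (hZ : AvoidsSum (Nat.card A) 0 T) {x : A}
    (hx : AvoidsSum (Nat.card A - 2) x T) :
    ∃ a b, addOrderOf (b - a) = Nat.card A ∧ x = -(a + b) ∧
      T = Multiset.replicate (Nat.card A - 1) a + Multiset.replicate (Nat.card A - 1) b := by
  classical
  obtain ⟨a, b, hab, hrep⟩ := hZ.eq_replicate_add_replicate hA hT
  have hne : a ≠ b := by
    rintro rfl
    rw [sub_self, addOrderOf_zero] at hab
    omega
  have hab' : AvoidsSum (Nat.card A - 2) (-(a + b)) T := by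
    intro Z hZT hZc hZs
    refine hZ (Z + {a, b}) (Multiset.le_iff_count.2 fun c => ?_) ?_ ?_
    · have hZc' : Z.count c ≤ Nat.card A - 2 := hZc ▸ Z.count_le_card c
      have hZT' := Multiset.count_le_of_le c hZT
      simp only [hrep, Multiset.insert_eq_cons, Multiset.count_add, Multiset.count_replicate,
        Multiset.count_cons, Multiset.count_singleton] at hZT' ⊢
      grind
    · rw [Multiset.card_add, hZc, Multiset.card_pair]
      omega
    · rw [Multiset.sum_add, hZs, Multiset.sum_pair, neg_add_cancel]
  have ha : a ∈ T := by
    rw [hrep]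
    exact Multiset.mem_add.2 (Or.inl (Multiset.mem_replicate.2 ⟨by omega, rfl⟩))
  have hle : T.erase a ≤ T := Multiset.erase_le a T
  exact ⟨a, b, hab, AvoidsSum.unique hA (by rw [Multiset.card_erase_of_mem ha, hT]; rfl)
    (hZ.mono hle) (hx.mono hle) (hab'.mono hle), hrep⟩

end Cyclic

section Planes

variable {V : Type*} [AddCommGroup V]

/-- The cosets of `{0, d}` through `x` and `y` are distinct. -/
def DistinctLines (d x y : V) : Prop := x ≠ y ∧ x ≠ y + d

theorem exists_pairwise_distinctLines_cons [Fintype V] {d : V} {l : List V}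
    (hl : 2 * l.length < Fintype.card V) (h : l.Pairwise (DistinctLines d)) :
    ∃ x, (x :: l).Pairwise (DistinctLines d) := by
  classical
  obtain ⟨x, hx⟩ : ∃ x, x ∉ l.flatMap fun x => [x, x + d] := by
    by_contra! hall
    have hle := (Finset.card_le_card (s := Finset.univ)
      fun x _ => List.mem_toFinset.2 (hall x)).trans (List.toFinset_card_le _)
    rw [Finset.card_univ] at hle
    simp only [List.length_flatMap, List.length_cons, List.length_nil, List.map_const',
      List.sum_replicate, smul_eq_mul] at hle
    omega
  simp only [List.mem_flatMap, List.mem_cons, List.not_mem_nil, or_false, not_exists, not_and,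
    not_or] at hx
  exact ⟨x, List.pairwise_cons.2 ⟨hx, h⟩⟩

variable [Module (ZMod 2) V]

theorem add_add_self_cancel (x d : V) : x + d + d = x := by
  rw [add_assoc, ZModModule.add_self, add_zero]

theorem add_add_cancel_left_self (x y : V) : x + (x + y) = y := by
  rw [← add_assoc, ZModModule.add_self, zero_add]

theorem DistinctLines.symm {d x y : V} (h : DistinctLines d x y) : DistinctLines d y x :=
  ⟨h.1.symm, fun hyx => h.2 (by rw [hyx, add_add_self_cancel])⟩

theorem DistinctLines.add_left {d x y : V} (h : DistinctLines d x y) : DistinctLines d (x + d) y :=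
  ⟨fun hxy => h.2 (by rw [← hxy, add_add_self_cancel]), fun hxy => h.1 (add_right_cancel hxy)⟩

theorem nodup_flatMap_of_pairwise_distinctLines {d : V} (hd : d ≠ 0) {l : List V}
    (h : l.Pairwise (DistinctLines d)) : (l.flatMap fun x => [x, x + d]).Nodup := by
  refine List.nodup_flatMap.2 ⟨fun x _ => by simpa using hd, h.imp fun {x y} hxy => ?_⟩
  simp [Function.onFun, hxy.symm.1, hxy.symm.2, hxy.symm.add_left.1]

variable {G : Type*} [AddCommGroup G]

/-- The values of `f` on any four distinct elements of `W` with sum `0` add up to `c`. In a group of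
exponent two, these quadruples are the affine planes contained in `W`. -/
def HasPlaneSum (W : Finset V) (f : V → G) (c : G) : Prop :=
  ∀ F ⊆ W, F.card = 4 → ∑ v ∈ F, v = 0 → ∑ v ∈ F, f v = c

theorem exists_plane {W : Finset V} {d x y : V} (hd : d ≠ 0) (hxy : DistinctLines d x y)
    (hx : x ∈ W ∧ x + d ∈ W) (hy : y ∈ W ∧ y + d ∈ W) (f : V → G) :
    ∃ F ⊆ W, F.card = 4 ∧ ∑ v ∈ F, v = 0 ∧
      ∑ v ∈ F, f v = f x + f (x + d) + (f y + f (y + d)) := by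
  classical
  have hnodup : [x, x + d, y, y + d].Nodup :=
    nodup_flatMap_of_pairwise_distinctLines hd (l := [x, y]) (by simpa using hxy)
  refine ⟨[x, x + d, y, y + d].toFinset, ?_, List.toFinset_card_of_nodup hnodup, ?_, ?_⟩
  · intro z hz
    simp only [List.mem_toFinset, List.mem_cons, List.not_mem_nil, or_false] at hz
    rcases hz with rfl | rfl | rfl | rfl
    exacts [hx.1, hx.2, hy.1, hy.2]
  · rw [List.sum_toFinset _ hnodup]
    simp only [List.map_cons, List.map_nil, List.sum_cons, List.sum_nil, add_zero]
    rw [add_add_cancel_left_self y, add_assoc, add_add_cancel_left_self, ZModModule.add_self]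
  · rw [List.sum_toFinset _ hnodup]
    simp [add_assoc]

theorem HasPlaneSum.lines {W : Finset V} {f : V → G} {c : G} (h : HasPlaneSum W f c) {d x y : V}
    (hd : d ≠ 0) (hxy : DistinctLines d x y) (hx : x ∈ W ∧ x + d ∈ W) (hy : y ∈ W ∧ y + d ∈ W) :
    f x + f (x + d) + (f y + f (y + d)) = c := by
  obtain ⟨F, hF, hF4, hF0, hFf⟩ := exists_plane hd hxy hx hy f
  rw [← hFf, h F hF hF4 hF0]

theorem HasPlaneSum.line_eq {W : Finset V} {f : V → G} {c : G} (h : HasPlaneSum W f c) {d v w u : V}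
    (hd : d ≠ 0) (hl : [v, w, u].Pairwise (DistinctLines d))
    (hW : ∀ z ∈ [v, w, u], z ∈ W ∧ z + d ∈ W) :
    f w + f (w + d) = f v + f (v + d) ∧ f u + f (u + d) = f v + f (v + d) := by
  simp only [List.pairwise_cons, List.mem_cons, List.not_mem_nil, or_false, forall_eq_or_imp,
    forall_eq] at hl hW
  have hvw := h.lines hd hl.1.1 hW.1 hW.2.1
  have hvu := h.lines hd hl.1.2 hW.1 hW.2.2
  have hwu := h.lines hd hl.2.1 hW.2.1 hW.2.2
  rw [add_comm] at hvw
  exact ⟨add_right_cancel (hwu.trans hvu.symm), add_left_cancel (hwu.trans hvw.symm)⟩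

theorem exists_three_lines [Fintype V] (hV : Fintype.card V = 8) {W : Finset V} {d p v : V}
    (hW : ∀ z, z ≠ p → z ≠ p + d → z ∈ W) (hv : DistinctLines d p v) :
    ∃ w u, [v, w, u].Pairwise (DistinctLines d) ∧ ∀ z ∈ [v, w, u], z ∈ W ∧ z + d ∈ W := by
  obtain ⟨w, hw⟩ := exists_pairwise_distinctLines_cons (l := [v, p]) (by simp [hV])
    (by simpa using hv.symm)
  obtain ⟨u, hu⟩ := exists_pairwise_distinctLines_cons (by simp [hV]) hw
  simp only [List.pairwise_cons, List.mem_cons, List.not_mem_nil, or_false, forall_eq_or_imp,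
    forall_eq, List.Pairwise.nil, and_true, false_imp_iff, implies_true] at hu ⊢
  obtain ⟨⟨huw, huv, hup⟩, ⟨hwv, hwp⟩, -⟩ := hu
  have hmem {z : V} (hz : DistinctLines d z p) : z ∈ W ∧ z + d ∈ W :=
    ⟨hW z hz.1 hz.2, hW _ hz.add_left.1 hz.add_left.2⟩
  exact ⟨w, u, ⟨⟨hwv.symm, huv.symm⟩, huw.symm⟩, hmem hv.symm, hmem hwp, hmem hup⟩

theorem exists_compl_line [Fintype V] (hV : Fintype.card V = 8) {W : Finset V}
    (hW : 6 ≤ W.card) {v : V} (hv : v ∈ W) :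
    ∃ p d, d ≠ 0 ∧ DistinctLines d p v ∧ ∀ z, z ≠ p → z ≠ p + d → z ∈ W := by
  classical
  obtain ⟨T, hWT, hTv, hT⟩ := Finset.exists_subsuperset_card_eq (s := Wᶜ) (t := {v}ᶜ) (n := 2)
    (by simpa using hv) (by rw [Finset.card_compl]; omega)
    (by rw [Finset.card_compl, Finset.card_singleton]; omega)
  obtain ⟨p, q, hpq, rfl⟩ := Finset.card_eq_two.1 hT
  have hpd : p + (p + q) = q := add_add_cancel_left_self p q
  have hvpq : v ∉ ({p, q} : Finset V) := fun hv => by simpa using hTv hv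
  simp only [Finset.mem_insert, Finset.mem_singleton, not_or] at hvpq
  refine ⟨p, p + q, fun h => hpq ?_, DistinctLines.symm ⟨hvpq.1, hpd.symm ▸ hvpq.2⟩, ?_⟩
  · rw [← hpd, h, add_zero]
  · intro z hzp hzq
    rw [hpd] at hzq
    by_contra hz
    simpa [hzp, hzq] using hWT (Finset.mem_compl.2 hz)

theorem exists_plane_of_six_le_card [Fintype V] (hV : Fintype.card V = 8) {W : Finset V}
    (hW : 6 ≤ W.card) : ∃ F ⊆ W, F.card = 4 ∧ ∑ v ∈ F, v = 0 := by
  obtain ⟨v, hv⟩ := Finset.card_pos.1 (by omega : 0 < W.card)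
  obtain ⟨p, d, hd, hpv, hWp⟩ := exists_compl_line hV hW hv
  obtain ⟨w, u, hl, hlW⟩ := exists_three_lines hV hWp hpv
  simp only [List.pairwise_cons, List.mem_cons, List.not_mem_nil, or_false, forall_eq_or_imp,
    forall_eq] at hl hlW
  obtain ⟨F, hF, hF4, hF0, -⟩ := exists_plane hd hl.1.1 hlW.1 hlW.2.1 id
  exact ⟨F, hF, hF4, hF0⟩

theorem HasPlaneSum.apply_eq_apply [Fintype V] (hV : Fintype.card V = 8) {W : Finset V}
    (hW : 6 ≤ W.card) {f g : V → G} {b c : G} (hf : HasPlaneSum W f b) (hg : HasPlaneSum W g c)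
    {v : V} (hv : v ∈ W) (hfg : ∀ z ≠ v, f z = g z) : f v = g v := by
  obtain ⟨p, d, hd, hpv, hWp⟩ := exists_compl_line hV hW hv
  obtain ⟨w, u, hl, hlW⟩ := exists_three_lines hV hWp hpv
  have hvw := (hf.line_eq hd hl hlW).1.symm
  have hvw' := (hg.line_eq hd hl hlW).1.symm
  simp only [List.pairwise_cons, List.mem_cons, List.not_mem_nil, or_false, forall_eq_or_imp,
    forall_eq] at hl
  have hwv := hl.1.1.symm
  rw [hfg w hwv.1, hfg (w + d) hwv.add_left.1] at hvw
  have hvd : f (v + d) = g (v + d) := hfg _ fun h => hd (add_eq_left.1 h)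
  exact add_right_cancel (b := f (v + d)) (by rw [hvw, hvd, hvw'])

theorem HasPlaneSum.two_nsmul_add [Fintype V] (hV : Fintype.card V = 8) {W : Finset V}
    (hW : 7 ≤ W.card) {f : V → G} {c : G} (h : HasPlaneSum W f c) {x y : V} (hx : x ∈ W)
    (hy : y ∈ W) (hxy : x ≠ y) : 2 • f x + 2 • f y = c := by
  classical
  obtain ⟨T, hWT, hTxy, hT⟩ := Finset.exists_subsuperset_card_eq (s := Wᶜ) (t := {x, y}ᶜ) (n := 1)
    (fun z hz => by
      simp only [Finset.mem_compl, Finset.mem_insert, Finset.mem_singleton, not_or] at hz ⊢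
      exact ⟨fun h => hz (h ▸ hx), fun h => hz (h ▸ hy)⟩) (by rw [Finset.card_compl]; omega)
    (by rw [Finset.card_compl, Finset.card_pair hxy]; omega)
  obtain ⟨p, rfl⟩ := Finset.card_eq_one.1 hT
  have hyd : x + (x + y) = y := add_add_cancel_left_self x y
  have hd : x + y ≠ 0 := fun h => hxy (by rw [← hyd, h, add_zero])
  have hp : p ≠ x ∧ p ≠ y := by simpa using hTxy (Finset.mem_singleton_self p)
  obtain ⟨w, u, hl, hlW⟩ := exists_three_lines hV (d := x + y) (p := p) (v := x) (W := W)
    (fun z hzp _ => by by_contra hz; exact hzp (by simpa using hWT (Finset.mem_compl.2 hz)))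
    ⟨hp.1, hyd.symm ▸ hp.2⟩
  have hxw := (h.line_eq hd hl hlW).1
  simp only [List.pairwise_cons, List.mem_cons, List.not_mem_nil, or_false, forall_eq_or_imp,
    forall_eq] at hl hlW
  have := h.lines hd hl.1.1 hlW.1 hlW.2.1
  rw [hxw, hyd] at this
  rw [← this]
  abel

theorem HasPlaneSum.two_nsmul_apply [Fintype V] (hV : Fintype.card V = 8) {W : Finset V}
    (hW : 7 ≤ W.card) {f : V → G} {c : G} (h : HasPlaneSum W f c) {x y : V} (hx : x ∈ W)
    (hy : y ∈ W) : 2 • f x = 2 • f y := by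
  obtain rfl | hxy := eq_or_ne x y
  · rfl
  classical
  obtain ⟨z, hz⟩ : ((W.erase x).erase y).Nonempty := by
    rw [← Finset.card_pos, Finset.card_erase_of_mem (Finset.mem_erase.2 ⟨hxy.symm, hy⟩),
      Finset.card_erase_of_mem hx]
    omega
  simp only [Finset.mem_erase] at hz
  exact add_right_cancel ((h.two_nsmul_add hV hW hx hz.2.2 hz.2.1.symm).trans
    (h.two_nsmul_add hV hW hy hz.2.2 hz.1.symm).symm)

end Planes

section Pairs

theorem exists_le_card_eq {B : Type*} {k : ℕ} {P : Multiset B} (h : k ≤ P.card) :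
    ∃ Q ≤ P, Q.card = k := by
  have hpos : 0 < (P.powersetCard k).card := by
    rw [Multiset.card_powersetCard]
    exact Nat.choose_pos h
  obtain ⟨Q, hQ⟩ := Multiset.card_pos_iff_exists_mem.1 hpos
  exact ⟨Q, Multiset.mem_powersetCard.1 hQ⟩

theorem exists_le_map_eq {B C : Type*} {f : B → C} {P : Multiset B} {Z : Multiset C}
    (h : Z ≤ P.map f) : ∃ Q ≤ P, Q.map f = Z := by
  induction P using Quotient.inductionOn with | _ l
  induction Z using Quotient.inductionOn with | _ m
  obtain ⟨l', hl', hm⟩ := Multiset.coe_le.1 h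
  obtain ⟨k, hk, rfl⟩ := List.sublist_map_iff.1 hm
  exact ⟨k, Multiset.coe_le.2 hk.subperm, Multiset.coe_eq_coe.2 hl'⟩

theorem AvoidsSum.of_map {A B : Type*} [AddCommMonoid A] [AddCommMonoid B] {f : A →+ B} {ℓ : ℕ}
    {x : A} {T : Multiset A} (h : AvoidsSum ℓ (f x) (T.map f)) : AvoidsSum ℓ x T := by
  intro Z hZ hZℓ hZx
  exact h (Z.map f) (Multiset.map_le_map hZ) (by rwa [Multiset.card_map])
    (by rw [← map_multiset_sum, hZx])

variable {G : Type*}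

/-- The sequence of all components of a sequence of pairs. -/
def entries (P : Multiset (G × G)) : Multiset G := P.map Prod.fst + P.map Prod.snd

theorem card_entries (P : Multiset (G × G)) : (entries P).card = 2 * P.card := by
  simp [entries, two_mul]

theorem entries_cons (p : G × G) (P : Multiset (G × G)) :
    entries (p ::ₘ P) = p.1 ::ₘ p.2 ::ₘ entries P := by
  simp [entries, Multiset.cons_swap]

theorem entries_mono {P Q : Multiset (G × G)} (h : Q ≤ P) : entries Q ≤ entries P :=
  add_le_add (Multiset.map_le_map h) (Multiset.map_le_map h)

theorem mem_entries {P : Multiset (G × G)} {x : G} :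
    x ∈ entries P ↔ ∃ p ∈ P, x = p.1 ∨ x = p.2 := by
  simp only [entries, Multiset.mem_add, Multiset.mem_map]
  grind

theorem map_val_insert_update {V : Type*} [DecidableEq V] {W : Finset V} {s : V → G} {v : V}
    (hv : v ∉ W) (x : G) :
    (insert v W).val.map (Function.update s v x) = x ::ₘ W.val.map s := by
  rw [Finset.insert_val_of_notMem hv, Multiset.map_cons, Function.update_self]
  congr 1
  exact Multiset.map_congr rfl fun w hw =>
    Function.update_of_ne (ne_of_mem_of_not_mem hw hv) _ _

theorem cons_map_val_erase {V : Type*} [DecidableEq V] {W : Finset V} {s : V → G} {v : V}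
    (hv : v ∈ W) :
    s v ::ₘ (W.erase v).val.map s = W.val.map s := by
  rw [← Multiset.map_cons, Finset.erase_val, Multiset.cons_erase hv]

variable [AddCommGroup G]

/-- The sequence of the sums of a sequence of pairs. -/
def pairSums (P : Multiset (G × G)) : Multiset G := P.map fun p => p.1 + p.2

theorem card_pairSums (P : Multiset (G × G)) : (pairSums P).card = P.card :=
  Multiset.card_map _ _

theorem sum_entries (P : Multiset (G × G)) : (entries P).sum = (pairSums P).sum := by
  simp [entries, pairSums, Multiset.sum_map_add]

end Pairs

section FibreSplitting

variable {G V : Type*} [AddCommGroup G] [AddCommGroup V]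

/-- The sequence `S` contains the terms of the pairs in `P`, each taken from one fibre of `π`,
together with the terms `s v` for `v ∈ W`, one from each of the fibres over `W`. -/
structure FibreSplitting (π : G →+ V) (S : Multiset G) (P : Multiset (G × G)) (W : Finset V)
    (s : V → G) : Prop where
  le : entries P + W.val.map s ≤ S
  fibre_eq : ∀ p ∈ P, π p.1 = π p.2
  section_eq : ∀ v ∈ W, π (s v) = v

variable {π : G →+ V} {S : Multiset G} {P : Multiset (G × G)} {W : Finset V} {s : V → G} {x : G}

theorem FibreSplitting.mono (h : FibreSplitting π S P W s) {Q : Multiset (G × G)} (hQ : Q ≤ P) :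
    FibreSplitting π S Q W s :=
  ⟨(add_le_add_left (entries_mono hQ) _).trans h.le, fun p hp => h.fibre_eq p
    (Multiset.mem_of_le hQ hp), h.section_eq⟩

theorem FibreSplitting.insert_fibre [DecidableEq V] (h : FibreSplitting π S P W s) (hx : π x ∉ W)
    {T : Multiset G} (hT : x ::ₘ (entries P + W.val.map s) ≤ T) :
    FibreSplitting π T P (insert (π x) W) (Function.update s (π x) x) where
  le := by rwa [map_val_insert_update hx, Multiset.add_cons]
  fibre_eq := h.fibre_eq
  section_eq v hv := by
    rcases Finset.mem_insert.1 hv with rfl | hvW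
    · rw [Function.update_self]
    · rw [Function.update_of_ne (ne_of_mem_of_not_mem hvW hx), h.section_eq v hvW]

theorem FibreSplitting.erase_fibre [DecidableEq V] (h : FibreSplitting π S P W s) (hx : π x ∈ W)
    {T : Multiset G} (hT : x ::ₘ (entries P + W.val.map s) ≤ T) :
    FibreSplitting π T ((x, s (π x)) ::ₘ P) (W.erase (π x)) s where
  le := by
    rwa [entries_cons, Multiset.cons_add, Multiset.cons_add, ← Multiset.add_cons,
      cons_map_val_erase hx]
  fibre_eq := by simpa [h.section_eq _ hx] using h.fibre_eq
  section_eq v hv := h.section_eq v (Finset.mem_of_mem_erase hv)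

theorem exists_fibreSplitting (π : G →+ V) (S : Multiset G) :
    ∃ P W s, FibreSplitting π S P W s ∧ 2 * P.card + W.card = S.card := by
  classical
  induction S using Multiset.induction_on with
  | empty => exact ⟨0, ∅, 0, ⟨by simp [entries], by simp, by simp⟩, by simp⟩
  | cons x S ih =>
    obtain ⟨P, W, s, h, hcard⟩ := ih
    by_cases hx : π x ∈ W
    · refine ⟨_, _, s, h.erase_fibre hx (Multiset.cons_le_cons x h.le), ?_⟩
      rw [Multiset.card_cons, Multiset.card_cons, Finset.card_erase_of_mem hx]
      have := Finset.card_pos.2 ⟨_, hx⟩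
      omega
    · refine ⟨P, _, _, h.insert_fibre hx (Multiset.cons_le_cons x h.le), ?_⟩
      rw [Finset.card_insert_of_notMem hx, Multiset.card_cons]
      omega

theorem FibreSplitting.exists_cons (h : FibreSplitting π S P W s) (hx : x ∈ entries P) :
    ∃ y Q, Q.card + 1 = P.card ∧ Q ≤ P ∧ FibreSplitting π S ((x, y) ::ₘ Q) W s := by
  obtain ⟨p, hp, hxp⟩ := mem_entries.1 hx
  obtain ⟨Q, rfl⟩ := Multiset.exists_cons_of_mem hp
  refine hxp.elim (fun hx => ⟨p.2, Q, by simp, Multiset.le_cons_self Q p, hx ▸ h⟩) fun hx =>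
    ⟨p.1, Q, by simp, Multiset.le_cons_self Q p, ⟨?_, ?_, h.section_eq⟩⟩
  · rw [entries_cons, hx, Multiset.cons_swap, ← entries_cons]
    exact h.le
  · simpa [hx, h.fibre_eq p hp] using h.fibre_eq

theorem FibreSplitting.swap [DecidableEq V] (h : FibreSplitting π S P W s) (hx : x ∈ entries P)
    (hxW : π x ∈ W) :
    ∃ Q, Q.card = P.card ∧ FibreSplitting π S Q W (Function.update s (π x) x) := by
  obtain ⟨y, Q, hQ, hQP, hsplit⟩ := h.exists_cons hx
  have hxy : π x = π y := hsplit.fibre_eq _ (Multiset.mem_cons_self _ _)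
  have herase := (h.mono hQP).erase_fibre (hxy ▸ hxW) le_rfl
  rw [← hxy] at herase
  refine ⟨(y, s (π x)) ::ₘ Q, (Multiset.card_cons _ _).trans hQ, ?_⟩
  rw [← Finset.insert_erase hxW]
  refine herase.insert_fibre (Finset.notMem_erase _ _)
    (((Multiset.cons_le_cons_iff x).2 herase.le).trans ?_)
  have hle := hsplit.le
  rwa [entries_cons, Multiset.cons_add, Multiset.cons_add] at hle

theorem FibreSplitting.extract [DecidableEq V] (h : FibreSplitting π S P W s) (hx : x ∈ entries P)
    (hxW : π x ∉ W) :
    ∃ Q, Q.card + 1 = P.card ∧ Q ≤ P ∧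
      FibreSplitting π S Q (insert (π x) W) (Function.update s (π x) x) := by
  obtain ⟨y, Q, hQ, hQP, hsplit⟩ := h.exists_cons hx
  refine ⟨Q, hQ, hQP, (h.mono hQP).insert_fibre hxW (le_trans ?_ hsplit.le)⟩
  rw [entries_cons, Multiset.cons_add, Multiset.cons_le_cons_iff, Multiset.cons_add]
  exact Multiset.le_cons_self _ _

theorem FibreSplitting.exists_ker_lift (h : FibreSplitting π S P W s) [Module (ZMod 2) V] :
    ∃ T : Multiset π.ker, T.map π.ker.subtype = pairSums P := by
  have hker : ∀ x ∈ pairSums P, x ∈ π.ker := by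
    simp only [pairSums, Multiset.mem_map]
    rintro _ ⟨p, hp, rfl⟩
    rw [AddMonoidHom.mem_ker, map_add, h.fibre_eq p hp, ZModModule.add_self]
  lift pairSums P to Multiset π.ker using hker with T
  exact ⟨T, rfl⟩

theorem FibreSplitting.avoidsSum_pairSums (h : FibreSplitting π S P W s) {k ℓ : ℕ}
    (hS : AvoidsSum ℓ 0 S) {F : Finset V} (hF : F ⊆ W) (hk : 2 * k + F.card = ℓ) :
    AvoidsSum k (-∑ v ∈ F, s v) (pairSums P) := by
  intro Z hZ hZk hZs
  obtain ⟨Q, hQ, rfl⟩ := exists_le_map_eq hZ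
  rw [Multiset.card_map] at hZk
  refine hS (entries Q + F.val.map s) ((add_le_add (entries_mono hQ)
    (Multiset.map_le_map (Finset.val_le_iff.2 hF))).trans h.le) ?_ ?_
  · rw [Multiset.card_add, card_entries, Multiset.card_map, hZk, Finset.card_val, hk]
  · rw [Multiset.sum_add, sum_entries]
    exact add_eq_zero_iff_eq_neg.2 hZs

variable [Module (ZMod 2) V] [Finite π.ker] [IsAddCyclic π.ker]

theorem FibreSplitting.exists_hasPlaneSum (h : FibreSplitting π S P W s)
    (hπ : 2 ≤ Nat.card π.ker) (hS : AvoidsSum (2 * Nat.card π.ker) 0 S)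
    (hP : 2 * Nat.card π.ker - 3 ≤ P.card) : ∃ c, HasPlaneSum W s c := by
  obtain ⟨Q, hQP, hQ⟩ := exists_le_card_eq hP
  have hsplit := h.mono hQP
  obtain ⟨T, hT⟩ := hsplit.exists_ker_lift
  have hTcard : T.card = 2 * Nat.card π.ker - 3 := by
    rw [← Multiset.card_map π.ker.subtype, hT, card_pairSums, hQ]
  have hT0 : AvoidsSum (Nat.card π.ker) 0 T := by
    refine AvoidsSum.of_map (f := π.ker.subtype) ?_
    rw [hT, map_zero, ← neg_zero, ← Finset.sum_empty (f := s)]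
    exact hsplit.avoidsSum_pairSums hS (Finset.empty_subset W) (by rw [Finset.card_empty, add_zero])
  have hplane {F : Finset V} (hF : F ⊆ W) (hF4 : F.card = 4) (hF0 : ∑ v ∈ F, v = 0) :
      ∃ x : π.ker, x = -∑ v ∈ F, s v ∧ AvoidsSum (Nat.card π.ker - 2) x T := by
    have hmem : -∑ v ∈ F, s v ∈ π.ker := by
      rw [neg_mem_iff, AddMonoidHom.mem_ker, map_sum,
        Finset.sum_congr rfl fun v hv => h.section_eq v (hF hv), hF0]
    refine ⟨⟨_, hmem⟩, rfl, AvoidsSum.of_map (f := π.ker.subtype) ?_⟩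
    rw [hT]
    exact hsplit.avoidsSum_pairSums hS hF (by omega)
  by_cases hex : ∃ F ⊆ W, F.card = 4 ∧ ∑ v ∈ F, v = 0
  · obtain ⟨F, hF, hF4, hF0⟩ := hex
    refine ⟨∑ v ∈ F, s v, fun F' hF' hF'4 hF'0 => neg_injective ?_⟩
    obtain ⟨x, hx, hxT⟩ := hplane hF hF4 hF0
    obtain ⟨y, hy, hyT⟩ := hplane hF' hF'4 hF'0
    rw [← hx, ← hy, hT0.unique hπ hTcard hyT hxT]
  · exact ⟨0, fun F hF hF4 hF0 => (hex ⟨F, hF, hF4, hF0⟩).elim⟩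

theorem FibreSplitting.eq_section [Fintype V] (h : FibreSplitting π S P W s)
    (hV : Fintype.card V = 8) (hπ : 2 ≤ Nat.card π.ker)
    (hS : AvoidsSum (2 * Nat.card π.ker) 0 S) (hP : 2 * Nat.card π.ker - 3 ≤ P.card)
    (hW : 6 ≤ W.card) (hx : x ∈ entries P) (hxW : π x ∈ W) : x = s (π x) := by
  classical
  obtain ⟨Q, hQ, hswap⟩ := h.swap hx hxW
  obtain ⟨b, hb⟩ := h.exists_hasPlaneSum hπ hS hP
  obtain ⟨c, hc⟩ := hswap.exists_hasPlaneSum hπ hS (hQ ▸ hP)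
  have happly := hb.apply_eq_apply hV hW hc hxW fun z hz => (Function.update_of_ne hz _ _).symm
  rw [happly, Function.update_self]

end FibreSplitting

section Exclusions

variable {G V : Type*} [AddCommGroup G] [AddCommGroup V] [Module (ZMod 2) V] {π : G →+ V}
  {S : Multiset G} {P : Multiset (G × G)} {W : Finset V} {s : V → G} {x : G}

theorem FibreSplitting.card_le [IsAddCyclic π.ker] (h : FibreSplitting π S P W s)
    (hS : AvoidsSum (2 * Nat.card π.ker) 0 S) : P.card ≤ 2 * Nat.card π.ker - 2 := by
  by_contra! hP
  obtain ⟨T, hT⟩ := h.exists_ker_lift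
  obtain ⟨Z, hZT, hZ, hZ0⟩ := exists_zero_sum_of_le_card (T := T)
    (by rw [← Multiset.card_map π.ker.subtype, hT, card_pairSums]; omega)
  have havoid := h.avoidsSum_pairSums hS (Finset.empty_subset W) (k := Nat.card π.ker) rfl
  refine havoid (Z.map π.ker.subtype) (hT ▸ Multiset.map_le_map hZT) (by rwa [Multiset.card_map]) ?_
  rw [← map_multiset_sum, hZ0, map_zero, Finset.sum_empty, neg_zero]

theorem FibreSplitting.not_forall_add_eq (h : FibreSplitting π S P W s) [Fintype V]
    (hV : Fintype.card V = 8) (hπ : 2 ≤ Nat.card π.ker) (hS : AvoidsSum (2 * Nat.card π.ker) 0 S)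
    (hP : 2 * Nat.card π.ker - 3 ≤ P.card) (hW : 6 ≤ W.card) {g : G}
    (hg : HasPlaneSum W s (g + g)) : ¬ ∀ p ∈ P, p.1 + p.2 = g := by
  intro hsum
  obtain ⟨F, hF, hF4, hF0⟩ := exists_plane_of_six_le_card hV hW
  obtain ⟨p, hp⟩ := Multiset.card_pos_iff_exists_mem.1 (by omega : 0 < P.card)
  have hgker : π g = 0 := by
    rw [← hsum p hp, map_add, h.fibre_eq p hp, ZModModule.add_self]
  have hng : Nat.card π.ker • g = 0 :=
    congrArg Subtype.val (card_nsmul_eq_zero' (x := (⟨g, hgker⟩ : π.ker)))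
  have hpairs : pairSums P = Multiset.replicate P.card g := by
    rw [pairSums, Multiset.map_congr rfl hsum, Multiset.map_const']
  have havoid := h.avoidsSum_pairSums hS hF (k := Nat.card π.ker - 2) (by omega)
  refine havoid (Multiset.replicate (Nat.card π.ker - 2) g)
    (hpairs ▸ (Multiset.replicate_le_replicate g).2 (by omega)) (Multiset.card_replicate _ _) ?_
  rw [Multiset.sum_replicate, hg F hF hF4 hF0, ← add_eq_zero_iff_eq_neg, ← two_nsmul, ← add_nsmul,
    Nat.sub_add_cancel hπ, hng]

variable [Fintype V] [Finite π.ker] [IsAddCyclic π.ker]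

theorem FibreSplitting.exists_notMem (h : FibreSplitting π S P W s) (hV : Fintype.card V = 8)
    (hπ : 2 ≤ Nat.card π.ker) (hS : AvoidsSum (2 * Nat.card π.ker) 0 S)
    (hP : 2 * Nat.card π.ker - 3 ≤ P.card) (hW : 7 ≤ W.card) : ∃ x ∈ entries P, π x ∉ W := by
  by_contra! hPW
  obtain ⟨c, hc⟩ := h.exists_hasPlaneSum hπ hS hP
  obtain ⟨v, hv, w, hw, hvw⟩ := Finset.one_lt_card.1 (by omega : 1 < W.card)
  have hdouble {z : V} (hz : z ∈ W) : 2 • s z = 2 • s v := hc.two_nsmul_apply hV hW hz hv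
  have hc' : c = 2 • s v + 2 • s v := by
    rw [← hc.two_nsmul_add hV hW hv hw hvw, hdouble hw]
  refine h.not_forall_add_eq hV hπ hS hP (by omega) (hc' ▸ hc) fun p hp => ?_
  have hp1 := mem_entries.2 ⟨p, hp, Or.inl rfl⟩
  have hp2 := mem_entries.2 ⟨p, hp, Or.inr rfl⟩
  rw [h.eq_section hV hπ hS hP (by omega) hp1 (hPW _ hp1),
    h.eq_section hV hπ hS hP (by omega) hp2 (hPW _ hp2), ← h.fibre_eq p hp, ← two_nsmul,
    hdouble (hPW _ hp1)]

theorem AvoidsSum.card_le (hV : Fintype.card V = 8) (hπ : 2 ≤ Nat.card π.ker)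
    (hS : AvoidsSum (2 * Nat.card π.ker) 0 S) : S.card ≤ 4 * Nat.card π.ker + 2 := by
  classical
  by_contra! hScard
  obtain ⟨P, W, s, h, hcard⟩ := exists_fibreSplitting π S
  have hP := h.card_le hS
  have hW := hV ▸ W.card_le_univ
  obtain ⟨x, hx, hxW⟩ := h.exists_notMem hV hπ hS (by omega) (by omega)
  obtain ⟨Q, hQ, -, hsplit⟩ := h.extract hx hxW
  have hW' := Finset.card_insert_of_notMem hxW
  obtain ⟨y, -, hy⟩ := hsplit.exists_notMem hV hπ hS (by omega) (by omega)
  have hlt := hV ▸ Finset.card_lt_univ_of_notMem hy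
  omega

theorem FibreSplitting.fst_eq_snd (h : FibreSplitting π S P W s) (hV : Fintype.card V = 8)
    (hπ : 2 ≤ Nat.card π.ker) (hS : AvoidsSum (2 * Nat.card π.ker) 0 S)
    (hP : 2 * Nat.card π.ker - 2 ≤ P.card) (hW : 6 ≤ W.card) {p : G × G} (hp : p ∈ P) :
    p.1 = p.2 := by
  classical
  by_cases hpW : π p.1 ∈ W
  · rw [h.eq_section hV hπ hS (by omega) hW (mem_entries.2 ⟨p, hp, Or.inl rfl⟩) hpW,
      h.eq_section hV hπ hS (by omega) hW (mem_entries.2 ⟨p, hp, Or.inr rfl⟩)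
        (h.fibre_eq p hp ▸ hpW), h.fibre_eq p hp]
  obtain ⟨Q, rfl⟩ := Multiset.exists_cons_of_mem hp
  rw [Multiset.card_cons] at hP
  have hle := h.le
  rw [entries_cons, Multiset.cons_add, Multiset.cons_add] at hle
  have hQ := h.mono (Multiset.le_cons_self Q p)
  have hfst := hQ.insert_fibre hpW
    (((Multiset.cons_le_cons_iff p.1).2 (Multiset.le_cons_self _ p.2)).trans hle)
  have hsnd := hQ.insert_fibre (h.fibre_eq p hp ▸ hpW) ((Multiset.le_cons_self _ p.1).trans hle)
  rw [← h.fibre_eq p hp] at hsnd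
  obtain ⟨b, hb⟩ := hfst.exists_hasPlaneSum hπ hS (by omega)
  obtain ⟨c, hc⟩ := hsnd.exists_hasPlaneSum hπ hS (by omega)
  have happly := hb.apply_eq_apply hV (hW.trans (Finset.card_le_card (Finset.subset_insert _ _)))
    hc (Finset.mem_insert_self _ _) fun z hz => by
      rw [Function.update_of_ne hz, Function.update_of_ne hz]
  rwa [Function.update_self, Function.update_self] at happly

theorem FibreSplitting.two_nsmul_eq_of_notMem (h : FibreSplitting π S P W s)
    (hV : Fintype.card V = 8) (hπ : 2 ≤ Nat.card π.ker) (hS : AvoidsSum (2 * Nat.card π.ker) 0 S)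
    (hP : 2 * Nat.card π.ker - 2 ≤ P.card) (hW : 6 ≤ W.card) (hx : x ∈ entries P)
    (hxW : π x ∉ W) : (∀ v ∈ W, 2 • s v = 2 • x) ∧ HasPlaneSum W s (2 • x + 2 • x) := by
  classical
  obtain ⟨Q, hQ, -, hsplit⟩ := h.extract hx hxW
  have hW' : 7 ≤ (insert (π x) W).card := by
    rw [Finset.card_insert_of_notMem hxW]
    omega
  obtain ⟨c, hc⟩ := hsplit.exists_hasPlaneSum hπ hS (by omega)
  have hupdate {v : V} (hv : v ∈ W) : Function.update s (π x) x v = s v :=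
    Function.update_of_ne (ne_of_mem_of_not_mem hv hxW) _ _
  have hdouble : ∀ v ∈ W, 2 • s v = 2 • x := fun v hv => by
    have heq := hc.two_nsmul_apply hV hW' (Finset.mem_insert_of_mem hv)
      (Finset.mem_insert_self (π x) W)
    rwa [hupdate hv, Function.update_self] at heq
  refine ⟨hdouble, fun F hF hF4 hF0 => ?_⟩
  obtain ⟨v, hv⟩ := Finset.card_pos.1 (by omega : 0 < W.card)
  have hadd := hc.two_nsmul_add hV hW' (Finset.mem_insert_self _ _) (Finset.mem_insert_of_mem hv)
    (ne_of_mem_of_not_mem hv hxW).symm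
  rw [hupdate hv, Function.update_self, hdouble v hv] at hadd
  rw [hadd, ← hc F (hF.trans (Finset.subset_insert _ _)) hF4 hF0]
  exact Finset.sum_congr rfl fun v hv => (hupdate (hF hv)).symm

theorem FibreSplitting.map_mem_of_mem_entries (h : FibreSplitting π S P W s)
    (hV : Fintype.card V = 8) (hπ : 2 ≤ Nat.card π.ker) (hS : AvoidsSum (2 * Nat.card π.ker) 0 S)
    (hP : 2 * Nat.card π.ker - 2 ≤ P.card) (hW : 6 ≤ W.card) (hx : x ∈ entries P) : π x ∈ W := by
  by_contra hxW
  obtain ⟨v, hv⟩ := Finset.card_pos.1 (by omega : 0 < W.card)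
  obtain ⟨hdouble, hplane⟩ := h.two_nsmul_eq_of_notMem hV hπ hS hP hW hx hxW
  refine h.not_forall_add_eq hV hπ hS (by omega) hW hplane fun p hp => ?_
  have hpmem : p.1 ∈ entries P := mem_entries.2 ⟨p, hp, Or.inl rfl⟩
  rw [← h.fst_eq_snd hV hπ hS hP hW hp, ← two_nsmul]
  by_cases hpW : π p.1 ∈ W
  · rw [h.eq_section hV hπ hS (by omega) hW hpmem hpW, hdouble _ hpW]
  · rw [← (h.two_nsmul_eq_of_notMem hV hπ hS hP hW hpmem hpW).1 v hv, hdouble v hv]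

end Exclusions

section LineForm

theorem map_eq_sum_replicate_count {V B : Type*} [DecidableEq V] {l : List V} (hl : l.Nodup)
    {M : Multiset V} (hM : ∀ z ∈ M, z ∈ l) (g : V → B) :
    M.map g = (l.map fun z => Multiset.replicate (M.count z) (g z)).sum := by
  have hrep : M = ∑ z ∈ l.toFinset, Multiset.replicate (M.count z) z := by
    refine Multiset.ext.2 fun z => ?_
    rw [Multiset.count_sum']
    simp only [Multiset.count_replicate, Finset.sum_ite_eq', List.mem_toFinset]
    split_ifs with hz
    · rfl
    · exact Multiset.count_eq_zero.2 fun hzM => hz (hM z hzM)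
  rw [← List.sum_toFinset _ hl]
  conv_lhs => rw [hrep, ← Multiset.coe_mapAddMonoidHom, map_sum]
  simp only [Multiset.coe_mapAddMonoidHom, Multiset.map_replicate]

theorem val_eq_flatMap_of_pairwise_distinctLines {V : Type*} [AddCommGroup V] [Module (ZMod 2) V]
    {W : Finset V} {d : V} (hd : d ≠ 0) {l : List V} (hl : l.Pairwise (DistinctLines d))
    (hW : ∀ z ∈ l, z ∈ W ∧ z + d ∈ W) (hcard : W.card = 2 * l.length) :
    W.val = ↑(l.flatMap fun z => [z, z + d]) := by
  have hnodup := Multiset.coe_nodup.2 (nodup_flatMap_of_pairwise_distinctLines hd hl)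
  refine (Multiset.eq_of_le_of_card_le ((Multiset.le_iff_subset hnodup).2 fun x hx => ?_) ?_).symm
  · simp only [Multiset.mem_coe, List.mem_flatMap, List.mem_cons, List.not_mem_nil, or_false] at hx
    obtain ⟨z, hz, rfl | rfl⟩ := hx
    exacts [(hW _ hz).1, (hW _ hz).2]
  · simp [hcard, mul_comm]

variable {G V : Type*} [AddCommGroup G] [AddCommGroup V]

/-- The images of `e₁, e₂, f` under `π` are linearly independent modulo two. -/
def IndependentModTwo (π : G →+ V) (e₁ e₂ f : G) : Prop :=
  ∀ j₁ j₂ j₃ : ℤ, π (j₁ • e₁ + j₂ • e₂ + j₃ • f) = 0 → Even j₁ ∧ Even j₂ ∧ Even j₃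

/-- The shape of a sequence of length `4n + 2` without zero-sum subsequences of length `2n` over a
group of order `8n`, after a translation: its terms lie on the three lines `{0, f}`, `{e₁, f - e₁}`
and `{e₂, f - e₂}`, with odd multiplicities, and twice the terms that remain after one copy of each
line has been removed and the rest has been paired up form the sequence `0^(n-1) (2f)^(n-1)`. -/
structure LineForm (π : G →+ V) (n : ℕ) (T : Multiset G) (f e₁ e₂ : G) (α α' β β' γ γ' : ℕ) :
    Prop where
  independent : IndependentModTwo π e₁ e₂ f
  order : addOrderOf (2 • f) = n
  eq : T = Multiset.replicate (2 * α + 1) 0 + Multiset.replicate (2 * α' + 1) f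
    + (Multiset.replicate (2 * β + 1) e₁ + Multiset.replicate (2 * β' + 1) (f - e₁))
    + (Multiset.replicate (2 * γ + 1) e₂ + Multiset.replicate (2 * γ' + 1) (f - e₂))
  doubles : Multiset.replicate α 0 + Multiset.replicate α' (2 • f)
    + (Multiset.replicate β (2 • e₁) + Multiset.replicate β' (2 • (f - e₁)))
    + (Multiset.replicate γ (2 • e₂) + Multiset.replicate γ' (2 • (f - e₂)))
    = Multiset.replicate (n - 1) 0 + Multiset.replicate (n - 1) (2 • f)

variable {π : G →+ V} {S : Multiset G} {M : Multiset V} {W : Finset V} {s : V → G} {x : G}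

theorem FibreSplitting.eq_map (h : FibreSplitting π S (M.map fun v => (s v, s v)) W s)
    (hcard : S.card = 2 * M.card + W.card) : S = (M + M + W.val).map s := by
  have hentries : entries (M.map fun v => (s v, s v)) = (M + M).map s := by
    simp [entries, Multiset.map_map]
  rw [Multiset.map_add, ← hentries]
  refine (Multiset.eq_of_le_of_card_le h.le ?_).symm
  rw [Multiset.card_add, card_entries, Multiset.card_map, Multiset.card_map, Finset.card_val, hcard]

theorem FibreSplitting.translate_eq_sum [DecidableEq V]
    (h : FibreSplitting π S (M.map fun v => (s v, s v)) W s)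
    (hcard : S.card = 2 * M.card + W.card) {l : List V} (hl : l.Nodup) (hW : W.val = l)
    (hMW : ∀ z ∈ M, z ∈ W) (g : G) :
    translate g S = (l.map fun z => Multiset.replicate (2 * M.count z + 1) (g + s z)).sum := by
  have hMl : ∀ z ∈ M + M + ↑l, z ∈ l := by
    intro z hz
    simp only [← Multiset.mem_coe, ← hW, Multiset.mem_add, or_self, Finset.mem_val] at hz ⊢
    exact hz.elim (hMW z) id
  rw [h.eq_map hcard, translate, Multiset.map_map, hW, map_eq_sum_replicate_count hl hMl]
  refine congrArg _ (List.map_congr_left fun z hz => ?_)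
  rw [Multiset.count_add, Multiset.count_add, Multiset.coe_count,
    List.count_eq_one_of_mem hl hz, two_mul, Function.comp_apply]

variable [Module (ZMod 2) V]

theorem map_zsmul_of_even {j : ℤ} (hj : Even j) : π (j • x) = 0 := by
  obtain ⟨i, rfl⟩ := hj
  rw [add_smul, map_add, ZModModule.add_self]

theorem map_zsmul_of_odd {j : ℤ} (hj : Odd j) : π (j • x) = π x := by
  obtain ⟨i, rfl⟩ := hj
  rw [add_smul, map_add, map_zsmul_of_even (even_two_mul i), one_smul, zero_add]

theorem independentModTwo_of_distinctLines {y z u f : G} (hf : π f ≠ 0)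
    (h : [π y, π z, π u].Pairwise (DistinctLines (π f))) :
    IndependentModTwo π (z - y) (u - y) f := by
  intro j₁ j₂ j₃ hj
  simp only [List.pairwise_cons, List.mem_cons, List.not_mem_nil, or_false, forall_eq_or_imp,
    forall_eq, List.Pairwise.nil, and_true, false_imp_iff, implies_true] at h
  obtain ⟨⟨⟨hyz, hyz'⟩, hyu, hyu'⟩, hzu⟩ := h
  have hzu' := (DistinctLines.symm hzu).2
  have hsum : π z - π y + (π u - π y) = π z - π u := by
    rw [← ZModModule.neg_eq_self (π u - π y), neg_sub, sub_add_sub_cancel]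
  rw [map_add, map_add] at hj
  rcases Int.even_or_odd j₁ with h₁ | h₁ <;> rcases Int.even_or_odd j₂ with h₂ | h₂ <;>
    rcases Int.even_or_odd j₃ with h₃ | h₃ <;>
    simp only [map_zsmul_of_even, map_zsmul_of_odd, h₁, h₂, h₃, map_sub, zero_add, add_zero, hsum,
      sub_add_eq_add_sub, sub_eq_zero] at hj
  · exact ⟨h₁, h₂, h₃⟩
  · exact (hf hj).elim
  · exact (hyu hj.symm).elim
  · exact (hyu' hj.symm).elim
  · exact (hyz hj.symm).elim
  · exact (hyz' hj.symm).elim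
  · exact (hzu.1 hj).elim
  · exact (hzu' hj.symm).elim

theorem exists_diagonal_fibreSplitting [Fintype V] [Finite π.ker] [IsAddCyclic π.ker]
    (hV : Fintype.card V = 8) (hπ : 2 ≤ Nat.card π.ker) (hS : AvoidsSum (2 * Nat.card π.ker) 0 S)
    (hcard : S.card = 4 * Nat.card π.ker + 2) :
    ∃ (M : Multiset V) (W : Finset V) (s : V → G),
      FibreSplitting π S (M.map fun v => (s v, s v)) W s ∧
      (∀ v ∈ M, v ∈ W) ∧ M.card = 2 * Nat.card π.ker - 2 ∧ W.card = 6 := by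
  obtain ⟨P, W, s, h, hPW⟩ := exists_fibreSplitting π S
  have hP := h.card_le hS
  have hW := hV ▸ W.card_le_univ
  have hW7 : ¬ 7 ≤ W.card := fun hW7 => by
    obtain ⟨y, -, hy⟩ := h.exists_notMem hV hπ hS (by omega) hW7
    have hlt := hV ▸ Finset.card_lt_univ_of_notMem hy
    omega
  have hmem {p : G × G} (hp : p ∈ P) : π p.1 ∈ W :=
    h.map_mem_of_mem_entries hV hπ hS (by omega) (by omega) (mem_entries.2 ⟨p, hp, Or.inl rfl⟩)
  have hdiag {p : G × G} (hp : p ∈ P) : (s (π p.1), s (π p.1)) = p := by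
    have hp1 := mem_entries.2 ⟨p, hp, Or.inl rfl⟩
    rw [← h.eq_section hV hπ hS (by omega) (by omega) hp1 (hmem hp)]
    exact Prod.ext rfl (h.fst_eq_snd hV hπ hS (by omega) (by omega) hp)
  have hP' : (P.map fun p => π p.1).map (fun v => (s v, s v)) = P :=
    (Multiset.map_map _ _ _).trans ((Multiset.map_congr rfl fun p hp => hdiag hp).trans P.map_id')
  refine ⟨P.map fun p => π p.1, W, s, hP'.symm ▸ h, ?_, by rw [Multiset.card_map]; omega, by omega⟩
  simp only [Multiset.mem_map]
  rintro _ ⟨p, hp, rfl⟩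
  exact hmem hp

theorem FibreSplitting.map_two_nsmul [Fintype V] [Finite π.ker] [IsAddCyclic π.ker]
    (h : FibreSplitting π S (M.map fun v => (s v, s v)) W s)
    (hV : Fintype.card V = 8) (hW : 6 ≤ W.card) (hπ : 2 ≤ Nat.card π.ker)
    (hS : AvoidsSum (2 * Nat.card π.ker) 0 S) (hM : M.card = 2 * Nat.card π.ker - 2) :
    ∃ a b, addOrderOf (b - a) = Nat.card π.ker ∧ HasPlaneSum W s (a + b) ∧
      M.map (fun v => 2 • s v) =
        Multiset.replicate (Nat.card π.ker - 1) a + Multiset.replicate (Nat.card π.ker - 1) b := by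
  obtain ⟨T, hT⟩ := h.exists_ker_lift
  obtain ⟨F, hF, hF4, hF0⟩ := exists_plane_of_six_le_card hV hW
  obtain ⟨c, hc⟩ := h.exists_hasPlaneSum hπ hS (by rw [Multiset.card_map]; omega)
  have hTcard : T.card = 2 * Nat.card π.ker - 2 := by
    rw [← Multiset.card_map π.ker.subtype, hT, card_pairSums, Multiset.card_map, hM]
  have hT0 : AvoidsSum (Nat.card π.ker) 0 T := by
    refine AvoidsSum.of_map (f := π.ker.subtype) ?_
    rw [hT, map_zero, ← neg_zero, ← Finset.sum_empty (f := s)]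
    exact h.avoidsSum_pairSums hS (Finset.empty_subset W) (by rw [Finset.card_empty, add_zero])
  have hcker : -c ∈ π.ker := by
    rw [← hc F hF hF4 hF0, neg_mem_iff, AddMonoidHom.mem_ker, map_sum,
      Finset.sum_congr rfl fun v hv => h.section_eq v (hF hv), hF0]
  have hTc : AvoidsSum (Nat.card π.ker - 2) ⟨-c, hcker⟩ T := by
    refine AvoidsSum.of_map (f := π.ker.subtype) ?_
    rw [hT]
    exact hc F hF hF4 hF0 ▸ h.avoidsSum_pairSums hS hF (by omega)
  obtain ⟨a, b, hab, hcab, rfl⟩ := hT0.eq_replicate_and_eq_neg_add hπ hTcard hTc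
  refine ⟨a, b, ?_, ?_, ?_⟩
  · rw [← hab, ← AddSubgroup.addOrderOf_coe, AddSubgroup.coe_sub]
  · rwa [← AddSubgroup.coe_add, ← neg_injective (congrArg Subtype.val hcab)]
  · simpa [pairSums, Multiset.map_map, two_nsmul] using hT.symm

theorem FibreSplitting.exists_lineForm
    (h : FibreSplitting π S (M.map fun v => (s v, s v)) W s)
    (hcard : S.card = 2 * M.card + W.card) (hMW : ∀ v ∈ M, v ∈ W) (hW : W.card = 6) {n : ℕ}
    {a b : G} (hab : addOrderOf (b - a) = n) (hc : HasPlaneSum W s (a + b))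
    (hM2 : M.map (fun v => 2 • s v) = Multiset.replicate (n - 1) a + Multiset.replicate (n - 1) b)
    {d v w u : V} (hd : d ≠ 0) (hl : [v, w, u].Pairwise (DistinctLines d))
    (hlW : ∀ z ∈ [v, w, u], z ∈ W ∧ z + d ∈ W) (ha : 2 • s v = a) :
    ∃ g f e₁ e₂ : G, ∃ α α' β β' γ γ' : ℕ,
      LineForm π n (translate (-g) S) f e₁ e₂ α α' β β' γ γ' := by
  classical
  have hval := val_eq_flatMap_of_pairwise_distinctLines hd hl hlW hW
  have hnodup := nodup_flatMap_of_pairwise_distinctLines hd hl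
  have hML : ∀ z ∈ M, z ∈ [v, w, u].flatMap fun z => [z, z + d] :=
    fun z hz => Multiset.mem_coe.1 (hval ▸ hMW z hz)
  obtain ⟨hw, hu⟩ := hc.line_eq hd hl hlW
  simp only [List.mem_cons, List.not_mem_nil, or_false, forall_eq_or_imp, forall_eq] at hlW
  have hb : 2 • (s (v + d) - s v) = b - a := by
    have hvw := hc.lines hd (List.rel_of_pairwise_cons hl (by simp)) hlW.1 hlW.2.1
    rw [hw, ← ha, ← two_nsmul, smul_add] at hvw
    rw [smul_sub, add_left_cancel hvw, ha]
  have hT := h.translate_eq_sum hcard hnodup hval hMW (-s v)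
  simp only [neg_add_eq_sub] at hT
  have hD : (([v, w, u].flatMap fun z => [z, z + d]).map fun z =>
      Multiset.replicate (M.count z) (2 • (s z - s v))).sum =
        Multiset.replicate (n - 1) 0 + Multiset.replicate (n - 1) (b - a) := by
    rw [← map_eq_sum_replicate_count hnodup hML]
    have := congrArg (Multiset.map fun y => y - a) hM2
    simpa only [Multiset.map_map, Function.comp_def, ← ha, ← smul_sub, Multiset.map_add,
      Multiset.map_replicate, sub_self, smul_zero] using this
  have hsw : s (w + d) - s v = s (v + d) - s v - (s w - s v) := by
    rw [eq_sub_of_add_eq' hw]; abel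
  have hsu : s (u + d) - s v = s (v + d) - s v - (s u - s v) := by
    rw [eq_sub_of_add_eq' hu]; abel
  refine ⟨s v, s (v + d) - s v, s w - s v, s u - s v, M.count v, M.count (v + d), M.count w,
    M.count (w + d), M.count u, M.count (u + d), ?_, hb ▸ hab, ?_, ?_⟩
  · have hπd : π (s (v + d) - s v) = d := by
      rw [map_sub, h.section_eq _ hlW.1.1, h.section_eq _ hlW.1.2, add_sub_cancel_left]
    refine independentModTwo_of_distinctLines (by rwa [hπd]) ?_
    rwa [hπd, h.section_eq _ hlW.1.1, h.section_eq _ hlW.2.1.1, h.section_eq _ hlW.2.2.1]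
  · simpa [hsw, hsu, add_assoc] using hT
  · simpa [hsw, hsu, hb, add_assoc] using hD

theorem AvoidsSum.exists_lineForm [Fintype V] [Finite π.ker] [IsAddCyclic π.ker]
    (hV : Fintype.card V = 8) (hπ : 2 ≤ Nat.card π.ker) (hS : AvoidsSum (2 * Nat.card π.ker) 0 S)
    (hcard : S.card = 4 * Nat.card π.ker + 2) :
    ∃ g f e₁ e₂ : G, ∃ α α' β β' γ γ' : ℕ,
      LineForm π (Nat.card π.ker) (translate (-g) S) f e₁ e₂ α α' β β' γ γ' := by
  obtain ⟨M, W, s, h, hMW, hM, hW⟩ := exists_diagonal_fibreSplitting hV hπ hS hcard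
  obtain ⟨a, b, hab, hc, hM2⟩ := h.map_two_nsmul hV hW.ge hπ hS hM
  obtain ⟨v, hv, hva⟩ : ∃ v ∈ M, 2 • s v = a := by
    rw [← Multiset.mem_map, hM2, Multiset.mem_add, Multiset.mem_replicate]
    exact Or.inl ⟨by omega, rfl⟩
  obtain ⟨p, d, hd, hpv, hWp⟩ := exists_compl_line hV hW.ge (hMW v hv)
  obtain ⟨w, u, hl, hlW⟩ := exists_three_lines hV hWp hpv
  exact h.exists_lineForm (by omega) hMW hW hab hc hM2 hd hl hlW hva

end LineForm

section Bases

variable {G V : Type*} [AddCommGroup G] [AddCommGroup V] {π : G →+ V} {n : ℕ} {e₁ e₂ f : G}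

theorem IndependentModTwo.swap (h : IndependentModTwo π e₁ e₂ f) : IndependentModTwo π e₂ e₁ f := by
  intro j₁ j₂ j₃ hj
  rw [add_comm (j₁ • e₂)] at hj
  obtain ⟨h₂, h₁, h₃⟩ := h j₂ j₁ j₃ hj
  exact ⟨h₁, h₂, h₃⟩

theorem IndependentModTwo.sub_zsmul (h : IndependentModTwo π e₁ e₂ f) (k : ℤ) :
    IndependentModTwo π (e₁ - k • f) e₂ f := by
  intro j₁ j₂ j₃ hj
  obtain ⟨h₁, h₂, h₃⟩ := h j₁ j₂ (j₃ - j₁ * k) (by rw [← hj]; congr 1; module)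
  exact ⟨h₁, h₂, (Int.even_sub.1 h₃).2 (h₁.mul_right k)⟩

theorem IndependentModTwo.sub_left (h : IndependentModTwo π e₁ e₂ f) :
    IndependentModTwo π e₁ e₂ (f - e₁) := by
  intro j₁ j₂ j₃ hj
  obtain ⟨h₁, h₂, h₃⟩ := h (j₁ - j₃) j₂ j₃ (by rw [← hj]; congr 1; module)
  exact ⟨(Int.even_sub.1 h₁).2 h₃, h₂, h₃⟩

theorem IndependentModTwo.flip (h : IndependentModTwo π e₁ e₂ f) :
    IndependentModTwo π (f - e₁) e₂ f := by
  intro j₁ j₂ j₃ hj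
  obtain ⟨h₁, h₂, h₃⟩ := h (-j₁) j₂ (j₁ + j₃) (by rw [← hj]; congr 1; module)
  exact ⟨even_neg.1 h₁, h₂, (Int.even_add.1 h₃).1 (even_neg.1 h₁)⟩

theorem IndependentModTwo.ne_zero (h : IndependentModTwo π e₁ e₂ f) : e₁ ≠ 0 := by
  rintro rfl
  exact absurd (h 1 0 0 (by simp)).1 (by decide)

theorem IndependentModTwo.independent (h : IndependentModTwo π e₁ e₂ f) (h₁ : 2 • e₁ = 0)
    (h₂ : 2 • e₂ = 0) : Independent e₁ e₂ f := by
  intro j₁ j₂ j₃ hj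
  obtain ⟨⟨i₁, rfl⟩, ⟨i₂, rfl⟩, -⟩ := h j₁ j₂ j₃ (by rw [hj, map_zero])
  have hzero {e : G} (he : 2 • e = 0) (i : ℤ) : (i + i) • e = 0 := by
    rw [add_smul, ← smul_add, ← two_nsmul, he, smul_zero]
  rw [hzero h₁, hzero h₂, zero_add, zero_add] at hj
  exact ⟨hzero h₁ i₁, hzero h₂ i₂, hj⟩

theorem IndependentModTwo.addOrderOf_eq (h : IndependentModTwo π e₁ e₂ f)
    (hf : addOrderOf (2 • f) = n) : addOrderOf f = 2 * n := by
  obtain ⟨-, -, heven⟩ := h 0 0 (addOrderOf f) (by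
    simp only [natCast_zsmul, addOrderOf_nsmul_eq_zero, zero_smul, add_zero, map_zero])
  have hdvd : 2 ∣ addOrderOf f := even_iff_two_dvd.1 ((Int.even_coe_nat _).1 heven)
  rw [addOrderOf_nsmul' f two_ne_zero, Nat.gcd_eq_right hdvd] at hf
  rw [← hf, Nat.mul_div_cancel' hdvd]

variable [Module (ZMod 2) V] [Finite π.ker]

theorem two_nsmul_mem_ker (π : G →+ V) (x : G) : 2 • x ∈ π.ker := by
  rw [AddMonoidHom.mem_ker, map_nsmul, two_nsmul, ZModModule.add_self]

theorem ker_eq_zmultiples (hf : addOrderOf (2 • f) = Nat.card π.ker) :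
    AddSubgroup.zmultiples (2 • f) = π.ker := by
  refine AddSubgroup.eq_of_le_of_card_ge ?_ ?_
  · rw [AddSubgroup.zmultiples_le]
    exact two_nsmul_mem_ker π f
  · rw [Nat.card_zmultiples, hf]

theorem exists_two_nsmul_sub_zsmul_eq_zero (hf : addOrderOf (2 • f) = Nat.card π.ker) {e : G}
    (he : 2 • e ≠ 0) (hef : 2 • e ≠ 2 • f) :
    ∃ k : ℤ, 2 ≤ k ∧ k ≤ (Nat.card π.ker : ℤ) - 1 ∧ 2 • (e - k • f) = 0 := by
  classical
  have hmem : 2 • e ∈ AddSubgroup.zmultiples (2 • f) :=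
    ker_eq_zmultiples hf ▸ two_nsmul_mem_ker π e
  have hpos : 0 < addOrderOf (2 • f) := hf ▸ Nat.card_pos
  obtain ⟨k, hk, hke⟩ := Finset.mem_image.1
    ((addOrderOf_pos_iff.1 hpos).mem_zmultiples_iff_mem_range_addOrderOf.1 hmem)
  rw [Finset.mem_range, hf] at hk
  have hk0 : k ≠ 0 := fun h => he (by rw [← hke, h]; exact zero_nsmul _)
  have hk1 : k ≠ 1 := fun h => hef (by rw [← hke, h]; exact one_nsmul _)
  refine ⟨k, by omega, by omega, ?_⟩
  rw [smul_sub, ← hke, natCast_zsmul, smul_comm, sub_self]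

theorem IndependentModTwo.closure_eq_top [Fintype V] (hV : Fintype.card V = 8)
    (h : IndependentModTwo π e₁ e₂ f) (hf : addOrderOf (2 • f) = Nat.card π.ker) :
    AddSubgroup.closure {e₁, e₂, f} = ⊤ := by
  have hmem : ∀ y ∈ ({e₁, e₂, f} : Set G), y ∈ AddSubgroup.closure {e₁, e₂, f} :=
    fun y hy => AddSubgroup.subset_closure hy
  let comb (c : Fin 2 × Fin 2 × Fin 2) : G :=
    (c.1 : ℤ) • e₁ + (c.2.1 : ℤ) • e₂ + (c.2.2 : ℤ) • f
  have hinj : Function.Injective fun c => π (comb c) := by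
    intro c c' hcc'
    obtain ⟨h₁, h₂, h₃⟩ := h (c.1 - c'.1) (c.2.1 - c'.2.1) (c.2.2 - c'.2.2) (by
      rw [← sub_eq_zero.2 hcc', ← map_sub]
      congr 1
      module)
    simp only [Int.even_iff] at h₁ h₂ h₃
    exact Prod.ext (by omega) (Prod.ext (by omega) (by omega))
  have hsurj := ((Fintype.bijective_iff_injective_and_card _).2
    ⟨hinj, by rw [hV]; rfl⟩).surjective
  refine eq_top_iff.2 fun x _ => ?_
  obtain ⟨c, hc⟩ := hsurj (π x)
  have hker : x - comb c ∈ AddSubgroup.zmultiples (2 • f) := by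
    rw [ker_eq_zmultiples hf, AddMonoidHom.mem_ker, map_sub, sub_eq_zero]
    exact hc.symm
  rw [← sub_add_cancel x (comb c)]
  simp only [Set.mem_insert_iff, Set.mem_singleton_iff, forall_eq_or_imp, forall_eq] at hmem
  refine add_mem (AddSubgroup.zmultiples_le.2 (nsmul_mem hmem.2.2 2) hker) ?_
  exact add_mem (add_mem (zsmul_mem hmem.1 _) (zsmul_mem hmem.2.1 _)) (zsmul_mem hmem.2.2 _)

theorem IndependentModTwo.isBasis [Fintype V] (hV : Fintype.card V = 8)
    (h : IndependentModTwo π e₁ e₂ f) (h₁ : 2 • e₁ = 0) (h₂ : 2 • e₂ = 0)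
    (hf : addOrderOf (2 • f) = Nat.card π.ker) : IsBasis (Nat.card π.ker) e₁ e₂ f :=
  ⟨h.independent h₁ h₂, h.closure_eq_top hV hf, addOrderOf_eq_prime h₁ h.ne_zero,
    addOrderOf_eq_prime h₂ h.swap.ne_zero, h.addOrderOf_eq hf⟩

end Bases

section Classification

variable {G V : Type*} [AddCommGroup G] [AddCommGroup V] {π : G →+ V} {n : ℕ} {T : Multiset G}
  {f e₁ e₂ : G} {α α' β β' γ γ' : ℕ}

theorem LineForm.swap (h : LineForm π n T f e₁ e₂ α α' β β' γ γ') :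
    LineForm π n T f e₂ e₁ α α' γ γ' β β' where
  independent := h.independent.swap
  order := h.order
  eq := by rw [h.eq, add_right_comm]
  doubles := by rw [← h.doubles, add_right_comm]

theorem LineForm.flip (h : LineForm π n T f e₁ e₂ α α' β β' γ γ') :
    LineForm π n T f (f - e₁) e₂ α α' β' β γ γ' where
  independent := h.independent.flip
  order := h.order
  eq := by rw [h.eq, sub_sub_cancel, add_comm (Multiset.replicate _ e₁)]
  doubles := by rw [← h.doubles, sub_sub_cancel, add_comm (Multiset.replicate _ (2 • e₁))]

theorem LineForm.exists_normalized (h : LineForm π n T f e₁ e₂ α α' β β' γ γ') :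
    ∃ e β β', LineForm π n T f e e₂ α α' β β' γ γ' ∧
      (2 • e = 0 ∨ 2 • e ≠ 0 ∧ 2 • e ≠ 2 • f) := by
  by_cases hf : 2 • e₁ = 2 • f
  · exact ⟨_, _, _, h.flip, Or.inl (by rw [smul_sub, hf, sub_self])⟩
  · exact ⟨e₁, β, β', h, or_iff_not_imp_left.2 fun h0 => ⟨h0, hf⟩⟩

theorem LineForm.eq_zero (h : LineForm π n T f e₁ e₂ α α' β β' γ γ')
    (he : 2 • e₂ ≠ 0 ∧ 2 • e₂ ≠ 2 • f) : γ = 0 ∧ γ' = 0 := by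
  have hmem {y : G}
      (hy : y ∈ Multiset.replicate γ (2 • e₂) + Multiset.replicate γ' (2 • (f - e₂))) :
      y = 0 ∨ y = 2 • f := by
    have hy' := Multiset.mem_of_le (le_add_self.trans h.doubles.le) hy
    exact (Multiset.mem_add.1 hy').imp Multiset.eq_of_mem_replicate Multiset.eq_of_mem_replicate
  refine ⟨by_contra fun hγ => ?_, by_contra fun hγ => ?_⟩
  · have := hmem (Multiset.mem_add.2 (Or.inl (Multiset.mem_replicate.2 ⟨hγ, rfl⟩)))
    exact this.elim he.1 he.2
  · have := hmem (Multiset.mem_add.2 (Or.inr (Multiset.mem_replicate.2 ⟨hγ, rfl⟩)))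
    rw [smul_sub, sub_eq_zero, sub_eq_self] at this
    exact this.elim (fun hf => he.2 hf.symm) he.1

theorem replicate_add_replicate_inj {B : Type*} {a b : B} (hab : a ≠ b) {j k j' k' : ℕ}
    (h : Multiset.replicate j a + Multiset.replicate k b =
      Multiset.replicate j' a + Multiset.replicate k' b) : j = j' ∧ k = k' := by
  classical
  have ha := congrArg (Multiset.count a) h
  have hb := congrArg (Multiset.count b) h
  simp only [Multiset.count_add, Multiset.count_replicate, hab, hab.symm, ↓reduceIte, add_zero,
    zero_add] at ha hb
  exact ⟨ha, hb⟩

theorem LineForm.add_eq (h : LineForm π n T f e₁ e₂ α α' β β' γ γ') (hn : 2 ≤ n)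
    (h₁ : 2 • e₁ = 0 ∨ 2 • e₁ ≠ 0 ∧ 2 • e₁ ≠ 2 • f)
    (h₂ : 2 • e₂ = 0 ∨ 2 • e₂ ≠ 0 ∧ 2 • e₂ ≠ 2 • f) :
    α + β + γ = n - 1 ∧ α' + β' + γ' = n - 1 := by
  have hf : (0 : G) ≠ 2 • f := by
    intro hf
    have := h.order
    rw [← hf, addOrderOf_zero] at this
    omega
  have hdouble {e : G} {j j' : ℕ} (he : 2 • e = 0 ∨ j = 0 ∧ j' = 0) :
      Multiset.replicate j (2 • e) + Multiset.replicate j' (2 • (f - e)) =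
        Multiset.replicate j 0 + Multiset.replicate j' (2 • f) := by
    rcases he with he | ⟨rfl, rfl⟩
    · rw [smul_sub, he, sub_zero]
    · rfl
  have hdoubles := h.doubles
  rw [hdouble (h₁.imp_right h.swap.eq_zero), hdouble (h₂.imp_right h.eq_zero)] at hdoubles
  refine replicate_add_replicate_inj hf (Eq.trans ?_ hdoubles)
  simp only [Multiset.replicate_add]
  abel

theorem LineForm.formS3 (h : LineForm π n T f e₁ e₂ α α' β β' γ γ') (hn : 2 ≤ n)
    (h₁ : 2 • e₁ = 0) (h₂ : 2 • e₂ = 0) : FormS3 n e₁ e₂ f T := by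
  obtain ⟨hadd, hadd'⟩ := h.add_eq hn (Or.inl h₁) (Or.inl h₂)
  have hodd {e : G} (he : 2 • e = 0) (j : ℕ) : (2 * j + 1) • e = e := by
    rw [add_smul, mul_comm, mul_smul, he, smul_zero, zero_add, one_smul]
  refine ⟨α, β, γ, Multiset.replicate (2 * α' + 1) 0 + Multiset.replicate (2 * β' + 1) e₁
    + Multiset.replicate (2 * γ' + 1) e₂, by omega, by omega, by omega, hadd, ?_, ?_, ?_, ?_⟩
  · simp only [Multiset.card_add, Multiset.card_replicate]
    omega
  · intro d hd
    simp only [Multiset.mem_add, Multiset.mem_replicate] at hd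
    rcases hd with (⟨-, rfl⟩ | ⟨-, rfl⟩) | ⟨-, rfl⟩
    · exact zero_mem _
    · exact AddSubgroup.subset_closure (Or.inl rfl)
    · exact AddSubgroup.subset_closure (Or.inr rfl)
  · simp only [Multiset.sum_add, Multiset.sum_replicate, smul_zero, zero_add, hodd h₁, hodd h₂,
      Multiset.mem_add, Multiset.mem_replicate]
    rintro ((⟨-, h0⟩ | ⟨-, h0⟩) | ⟨-, h0⟩)
    · exact absurd (h.independent 1 1 0 (by simp [h0])).1 (by decide)
    · exact h.independent.swap.ne_zero (add_eq_left.1 h0)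
    · exact h.independent.ne_zero (add_eq_right.1 h0)
  · have hsub {e : G} (he : 2 • e = 0) : f - e = f + e := by
      rw [sub_eq_add_neg, neg_eq_of_add_eq_zero_left (two_nsmul e ▸ he)]
    rw [h.eq, hsub h₁, hsub h₂]
    simp only [Multiset.map_add, Multiset.map_replicate, add_zero]
    abel

theorem LineForm.formS1 (h : LineForm π n T f e₁ e₂ α α' β β' γ γ') (hn : 2 ≤ n)
    (h₁ : 2 • e₁ = 0) (h₂ : 2 • e₂ ≠ 0 ∧ 2 • e₂ ≠ 2 • f) {k : ℤ} (hk : 2 ≤ k)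
    (hkn : k ≤ (n : ℤ) - 1) (hke : 2 • (e₂ - k • (f - e₁)) = 0) :
    FormS1 n (e₂ - k • (f - e₁)) e₁ (f - e₁) T := by
  obtain ⟨hadd, hadd'⟩ := h.add_eq hn (Or.inl h₁) (Or.inr h₂)
  obtain ⟨rfl, rfl⟩ := h.eq_zero h₂
  have hlast : (1 - k) • (f - e₁) + e₁ + (e₂ - k • (f - e₁)) = f - e₂ := by
    rw [← sub_eq_zero, ← hke]
    module
  refine ⟨α, α', k, by omega, by omega, hk, hkn, ?_⟩
  rw [h.eq, hlast, add_sub_cancel, sub_add_cancel, show 2 * n - 2 * α - 1 = 2 * β + 1 by omega,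
    show 2 * n - 1 - 2 * α' = 2 * β' + 1 by omega, mul_zero, zero_add, Multiset.replicate_one,
    Multiset.replicate_one]
  abel

theorem LineForm.formS2 (h : LineForm π n T f e₁ e₂ α α' β β' γ γ') (hn : 2 ≤ n)
    (h₁ : 2 • e₁ ≠ 0 ∧ 2 • e₁ ≠ 2 • f) (h₂ : 2 • e₂ ≠ 0 ∧ 2 • e₂ ≠ 2 • f) {k l : ℤ}
    (hkn : k ≤ (n : ℤ) - 1) (hl : 2 ≤ l) (hlk : l ≤ k) (hke : 2 • (e₁ - k • f) = 0)
    (hle : 2 • (e₂ - l • f) = 0) : FormS2 n (e₂ - l • f) (e₁ - k • f) f T := by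
  obtain ⟨hadd, hadd'⟩ := h.add_eq hn (Or.inr h₁) (Or.inr h₂)
  obtain ⟨rfl, rfl⟩ := h.eq_zero h₂
  obtain ⟨rfl, rfl⟩ := h.swap.eq_zero h₁
  have hlast {e : G} {j : ℤ} (he : 2 • (e - j • f) = 0) : (1 - j) • f + (e - j • f) = f - e := by
    rw [← sub_eq_zero, ← he]
    module
  refine ⟨k, l, by omega, hkn, hl, by omega, hlk, ?_⟩
  rw [h.eq, hlast hke, hlast hle, add_sub_cancel, add_sub_cancel,
    show 2 * α + 1 = 2 * n - 1 by omega, show 2 * α' + 1 = 2 * n - 1 by omega, mul_zero, zero_add]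
  simp only [Multiset.replicate_one]
  abel

variable [Module (ZMod 2) V] [Fintype V] [Finite π.ker]

theorem LineForm.exists_basis_formS1 (h : LineForm π (Nat.card π.ker) T f e₁ e₂ α α' β β' γ γ')
    (hV : Fintype.card V = 8) (hπ : 2 ≤ Nat.card π.ker) (h₁ : 2 • e₁ = 0)
    (h₂ : 2 • e₂ ≠ 0 ∧ 2 • e₂ ≠ 2 • f) :
    ∃ f₁ f₂ f₃, IsBasis (Nat.card π.ker) f₁ f₂ f₃ ∧ FormS1 (Nat.card π.ker) f₁ f₂ f₃ T := by
  have hf : 2 • (f - e₁) = 2 • f := by rw [smul_sub, h₁, sub_zero]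
  have horder : addOrderOf (2 • (f - e₁)) = Nat.card π.ker := hf ▸ h.order
  obtain ⟨k, hk, hkn, hke⟩ := exists_two_nsmul_sub_zsmul_eq_zero horder h₂.1 (hf ▸ h₂.2)
  exact ⟨_, _, _, (h.independent.sub_left.swap.sub_zsmul k).isBasis hV hke h₁ horder,
    h.formS1 hπ h₁ h₂ hk hkn hke⟩

theorem LineForm.exists_basis_formS2 (h : LineForm π (Nat.card π.ker) T f e₁ e₂ α α' β β' γ γ')
    (hV : Fintype.card V = 8) (hπ : 2 ≤ Nat.card π.ker) (h₁ : 2 • e₁ ≠ 0 ∧ 2 • e₁ ≠ 2 • f)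
    (h₂ : 2 • e₂ ≠ 0 ∧ 2 • e₂ ≠ 2 • f) :
    ∃ f₁ f₂ f₃, IsBasis (Nat.card π.ker) f₁ f₂ f₃ ∧ FormS2 (Nat.card π.ker) f₁ f₂ f₃ T := by
  obtain ⟨k, hk, hkn, hke⟩ := exists_two_nsmul_sub_zsmul_eq_zero h.order h₁.1 h₁.2
  obtain ⟨l, hl, hln, hle⟩ := exists_two_nsmul_sub_zsmul_eq_zero h.order h₂.1 h₂.2
  rcases le_total l k with hlk | hkl
  · exact ⟨_, _, _, ((h.independent.sub_zsmul k).swap.sub_zsmul l).isBasis hV hle hke h.order,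
      h.formS2 hπ h₁ h₂ hkn hl hlk hke hle⟩
  · exact ⟨_, _, _, ((h.independent.swap.sub_zsmul l).swap.sub_zsmul k).isBasis hV hke hle h.order,
      h.swap.formS2 hπ h₂ h₁ hln hk hkl hle hke⟩

theorem LineForm.exists_basis (h : LineForm π (Nat.card π.ker) T f e₁ e₂ α α' β β' γ γ')
    (hV : Fintype.card V = 8) (hπ : 2 ≤ Nat.card π.ker) :
    ∃ f₁ f₂ f₃, IsBasis (Nat.card π.ker) f₁ f₂ f₃ ∧ (FormS1 (Nat.card π.ker) f₁ f₂ f₃ T ∨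
      FormS2 (Nat.card π.ker) f₁ f₂ f₃ T ∨ FormS3 (Nat.card π.ker) f₁ f₂ f₃ T) := by
  obtain ⟨e₁, β, β', h, h₁⟩ := h.exists_normalized
  obtain ⟨e₂, γ, γ', h, h₂⟩ := h.swap.exists_normalized
  rcases h₁ with h₁ | h₁ <;> rcases h₂ with h₂ | h₂
  · exact ⟨_, _, _, h.independent.isBasis hV h₂ h₁ h.order, Or.inr (Or.inr (h.formS3 hπ h₂ h₁))⟩
  · obtain ⟨f₁, f₂, f₃, hbasis, hform⟩ := h.swap.exists_basis_formS1 hV hπ h₁ h₂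
    exact ⟨f₁, f₂, f₃, hbasis, Or.inl hform⟩
  · obtain ⟨f₁, f₂, f₃, hbasis, hform⟩ := h.exists_basis_formS1 hV hπ h₂ h₁
    exact ⟨f₁, f₂, f₃, hbasis, Or.inl hform⟩
  · obtain ⟨f₁, f₂, f₃, hbasis, hform⟩ := h.exists_basis_formS2 hV hπ h₂ h₁
    exact ⟨f₁, f₂, f₃, hbasis, Or.inr (Or.inl hform)⟩

end Classification

section Converse

theorem exists_add_of_le_add {B : Type*} {Z S T : Multiset B} (h : Z ≤ S + T) :
    ∃ X ≤ S, ∃ Y ≤ T, Z = X + Y := by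
  classical
  refine ⟨Z ∩ S, Multiset.inter_le_right, Z - S, tsub_le_iff_left.2 h, ?_⟩
  rw [add_comm, Multiset.sub_add_inter]

theorem exists_add_replicate_of_le {B : Type*} {Z S : Multiset B} {m : ℕ} {x : B}
    (h : Z ≤ S + Multiset.replicate m x) : ∃ Y ≤ S, ∃ i ≤ m, Z = Y + Multiset.replicate i x := by
  obtain ⟨Y, hY, X, hX, rfl⟩ := exists_add_of_le_add h
  obtain ⟨i, hi, rfl⟩ := Multiset.le_replicate_iff.1 hX
  exact ⟨Y, hY, i, hi, rfl⟩

theorem exists_card_sum_of_le {A : Type*} [AddCommMonoid A] {x₁ x₂ x₃ x₄ x₅ x₆ : A}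
    {m₁ m₂ m₃ m₄ m₅ m₆ : ℕ} {Z : Multiset A}
    (h : Z ≤ Multiset.replicate m₁ x₁ + Multiset.replicate m₂ x₂ + Multiset.replicate m₃ x₃
      + Multiset.replicate m₄ x₄ + Multiset.replicate m₅ x₅ + Multiset.replicate m₆ x₆) :
    ∃ i₁ ≤ m₁, ∃ i₂ ≤ m₂, ∃ i₃ ≤ m₃, ∃ i₄ ≤ m₄, ∃ i₅ ≤ m₅, ∃ i₆ ≤ m₆,
      Z.card = i₁ + i₂ + i₃ + i₄ + i₅ + i₆ ∧
      Z.sum = i₁ • x₁ + i₂ • x₂ + i₃ • x₃ + i₄ • x₄ + i₅ • x₅ + i₆ • x₆ := by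
  obtain ⟨Z₅, hZ₅, i₆, h₆, rfl⟩ := exists_add_replicate_of_le h
  obtain ⟨Z₄, hZ₄, i₅, h₅, rfl⟩ := exists_add_replicate_of_le hZ₅
  obtain ⟨Z₃, hZ₃, i₄, h₄, rfl⟩ := exists_add_replicate_of_le hZ₄
  obtain ⟨Z₂, hZ₂, i₃, h₃, rfl⟩ := exists_add_replicate_of_le hZ₃
  obtain ⟨Z₁, hZ₁, i₂, h₂, rfl⟩ := exists_add_replicate_of_le hZ₂
  obtain ⟨i₁, h₁, rfl⟩ := Multiset.le_replicate_iff.1 hZ₁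
  refine ⟨i₁, h₁, i₂, h₂, i₃, h₃, i₄, h₄, i₅, h₅, i₆, h₆, ?_, ?_⟩
  · simp only [Multiset.card_add, Multiset.card_replicate]
  · simp only [Multiset.sum_add, Multiset.sum_replicate]

theorem eq_zero_or_eq_of_dvd {m k : ℤ} (h : m ∣ k) (hk : 0 ≤ k) (hkm : k < 2 * m) :
    k = 0 ∨ k = m := by
  by_cases hlt : k < m
  · exact Or.inl (Int.eq_zero_of_dvd_of_nonneg_of_lt hk hlt h)
  · have := Int.eq_zero_of_dvd_of_nonneg_of_lt (by omega) (by omega) (dvd_sub_self_right.2 h)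
    exact Or.inr (sub_eq_zero.1 this)

variable {G : Type*} [AddCommGroup G] {n : ℕ} {f₁ f₂ f₃ : G} {T : Multiset G}

theorem IsBasis.dvd (h : IsBasis n f₁ f₂ f₃) {i j k : ℤ} (hs : i • f₁ + j • f₂ + k • f₃ = 0) :
    2 ∣ i ∧ 2 ∣ j ∧ (2 * n : ℤ) ∣ k := by
  obtain ⟨hind, -, h₁, h₂, h₃⟩ := h
  obtain ⟨hi, hj, hk⟩ := hind i j k hs
  rw [← addOrderOf_dvd_iff_zsmul_eq_zero] at hi hj hk
  rw [h₁] at hi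
  rw [h₂] at hj
  rw [h₃] at hk
  exact ⟨mod_cast hi, mod_cast hj, mod_cast hk⟩

theorem FormS1.avoidsSum (h : FormS1 n f₁ f₂ f₃ T) (hb : IsBasis n f₁ f₂ f₃) :
    AvoidsSum (2 * n) 0 T := by
  obtain ⟨α, β, a, hα, hβ, ha, han, rfl⟩ := h
  intro Z hZ hcard hsum
  simp only [← Multiset.replicate_one] at hZ
  obtain ⟨i₁, h₁, i₂, h₂, i₃, h₃, i₄, h₄, i₅, h₅, i₆, h₆, hZcard, hZsum⟩ :=
    exists_card_sum_of_le hZ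
  obtain ⟨hf₁, hf₂, hf₃⟩ := hb.dvd (i := i₅ + i₆) (j := i₂ + i₄ + i₆)
    (k := i₃ + i₄ + i₅ * a + i₆ * (1 - a)) (by rw [← hsum, hZsum]; module)
  obtain ⟨rfl, rfl⟩ | ⟨rfl, rfl⟩ : (i₅ = 0 ∧ i₆ = 0) ∨ (i₅ = 1 ∧ i₆ = 1) := by omega
  · have hdvd : (2 * n : ℤ) ∣ i₃ + i₄ := by simpa using hf₃
    rcases eq_zero_or_eq_of_dvd hdvd (by omega) (by omega) with h | h <;> omega
  · have hdvd : (2 * n : ℤ) ∣ i₃ + i₄ + 1 := by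
      convert hf₃ using 1
      push_cast
      ring
    rcases eq_zero_or_eq_of_dvd hdvd (by omega) (by omega) with h | h <;> omega

theorem FormS2.avoidsSum (h : FormS2 n f₁ f₂ f₃ T) (hb : IsBasis n f₁ f₂ f₃) :
    AvoidsSum (2 * n) 0 T := by
  obtain ⟨a, b, ha, han, -, -, -, rfl⟩ := h
  intro Z hZ hcard hsum
  simp only [← Multiset.replicate_one] at hZ
  obtain ⟨i₁, h₁, i₂, h₂, i₃, h₃, i₄, h₄, i₅, h₅, i₆, h₆, hZcard, hZsum⟩ :=
    exists_card_sum_of_le hZ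
  obtain ⟨hf₁, hf₂, hf₃⟩ := hb.dvd (i := i₅ + i₆) (j := i₃ + i₄)
    (k := i₂ + i₃ * a + i₄ * (1 - a) + i₅ * b + i₆ * (1 - b)) (by rw [← hsum, hZsum]; module)
  obtain rfl : i₃ = i₄ := by omega
  obtain rfl : i₅ = i₆ := by omega
  have hdvd : (2 * n : ℤ) ∣ i₂ + i₃ + i₅ := by
    convert hf₃ using 1
    ring
  rcases eq_zero_or_eq_of_dvd hdvd (by omega) (by omega) with h | h <;> omega

theorem FormS3.avoidsSum (h : FormS3 n f₁ f₂ f₃ T) (hn : 0 < n) (hb : IsBasis n f₁ f₂ f₃) :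
    AvoidsSum (2 * n) 0 T := by
  obtain ⟨α, β, γ, D, -, -, -, hadd, hDcard, hD, hDsum, rfl⟩ := h
  intro Z hZ hcard hsum
  obtain ⟨Z₃, hZ₃, X, hX, rfl⟩ := exists_add_of_le_add hZ
  obtain ⟨E, hE, rfl⟩ := exists_le_map_eq hX
  obtain ⟨Z₂, hZ₂, i₃, h₃, rfl⟩ := exists_add_replicate_of_le hZ₃
  obtain ⟨Z₁, hZ₁, i₂, h₂, rfl⟩ := exists_add_replicate_of_le hZ₂
  obtain ⟨i₁, h₁, rfl⟩ := Multiset.le_replicate_iff.1 hZ₁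
  obtain ⟨x, y, hxy⟩ := AddSubgroup.mem_closure_pair.1 <| AddSubgroup.multiset_sum_mem _ E
    fun d hd => hD d (Multiset.mem_of_le hE hd)
  simp only [Multiset.card_add, Multiset.card_replicate, Multiset.card_map] at hcard
  have hEf : (E.map fun d => f₃ + d).sum = E.card • f₃ + E.sum := sum_translate f₃ E
  simp only [Multiset.sum_add, Multiset.sum_replicate, smul_zero, zero_add, hEf] at hsum
  obtain ⟨hf₁, hf₂, hf₃⟩ := hb.dvd (i := i₂ + x) (j := i₃ + y) (k := E.card)
    (by rw [← hsum, ← hxy]; module)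
  have hEcard := Multiset.card_le_card hE
  rcases eq_zero_or_eq_of_dvd hf₃ (by omega) (by omega) with h | h
  · obtain rfl : E = 0 := Multiset.card_eq_zero.1 (by omega)
    obtain ⟨hx, hy, -⟩ := hb.dvd (i := x) (j := y) (k := 0) (by simp [hxy])
    rw [Multiset.card_zero] at hcard
    omega
  · obtain ⟨F, rfl⟩ := Multiset.le_iff_exists_add.1 hE
    rw [Multiset.card_add] at hDcard
    obtain ⟨d, rfl⟩ := Multiset.card_eq_one.1 (by omega : F.card = 1)
    obtain ⟨rfl, rfl⟩ : i₂ = 0 ∧ i₃ = 0 := by omega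
    have hf : E.card • f₃ = 0 := by
      rw [show E.card = addOrderOf f₃ by rw [hb.2.2.2.2]; omega, addOrderOf_nsmul_eq_zero]
    have hEsum : E.sum = 0 := by simpa only [zero_smul, hf, zero_add] using hsum
    exact hDsum (by simp [hEsum])

end Converse

section Main

variable {G : Type*} [AddCommGroup G] {n : ℕ} {S : Multiset G}

theorem zero_notMem_subsums_iff {ℓ : ℕ} (hℓ : ℓ ≠ 0) :
    (0 : G) ∉ subsums {ℓ} S ↔ AvoidsSum ℓ 0 S := by
  constructor
  · intro h Z hZ hcard hsum
    refine h ⟨Z, hZ, ?_, hcard, hsum⟩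
    rintro rfl
    exact hℓ hcard.symm
  · rintro h ⟨Z, hZ, -, hcard, hsum⟩
    exact h Z hZ hcard hsum

theorem egzConstant_eq_succ {m : ℕ} (hexp : AddMonoid.exponent G ≠ 0)
    (hle : ∀ T : Multiset G, AvoidsSum (AddMonoid.exponent G) 0 T → T.card ≤ m)
    (hS : AvoidsSum (AddMonoid.exponent G) 0 S) (hcard : S.card = m) :
    egzConstant G = ((m + 1 : ℕ) : ℕ∞) := by
  refine le_antisymm (sInf_le ⟨m + 1, fun T hT => ?_, rfl⟩) (le_sInf ?_)
  · by_contra hno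
    exact absurd (hle T ((zero_notMem_subsums_iff hexp).1 hno)) (by omega)
  · rintro _ ⟨ℓ, hℓ, rfl⟩
    refine Nat.cast_le.2 (Nat.succ_le_of_lt ?_)
    by_contra! hlt
    exact (zero_notMem_subsums_iff hexp).2 hS (hℓ S (by omega))

theorem IsBasis.exists_formS3 {f₁ f₂ f₃ : G} (hb : IsBasis n f₁ f₂ f₃) (hn : 0 < n) :
    ∃ T, T.card = 4 * n + 2 ∧ FormS3 n f₁ f₂ f₃ T := by
  refine ⟨_, ?_, n - 1, 0, 0, Multiset.replicate (2 * n - 1) 0 + {f₁} + {f₂}, le_rfl,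
    by omega, by omega, by omega, ?_, ?_, ?_, rfl⟩
  · simp only [Multiset.card_add, Multiset.card_replicate, Multiset.card_map,
      Multiset.card_singleton]
    omega
  · simp only [Multiset.card_add, Multiset.card_replicate, Multiset.card_singleton]
    omega
  · intro d hd
    simp only [Multiset.mem_add, Multiset.mem_replicate, Multiset.mem_singleton] at hd
    rcases hd with (⟨-, rfl⟩ | rfl) | rfl
    · exact zero_mem _
    · exact AddSubgroup.subset_closure (Or.inl rfl)
    · exact AddSubgroup.subset_closure (Or.inr rfl)
  · simp only [Multiset.sum_add, Multiset.sum_replicate, smul_zero, zero_add,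
      Multiset.sum_singleton, Multiset.mem_add, Multiset.mem_replicate, Multiset.mem_singleton]
    rintro ((⟨-, h⟩ | h) | h)
    · exact absurd (hb.dvd (i := 1) (j := 1) (k := 0) (by simp [h])).1 (by decide)
    · exact absurd (hb.dvd (i := 0) (j := 1) (k := 0) (by simp [add_eq_left.1 h])).2.1 (by decide)
    · exact absurd (hb.dvd (i := 1) (j := 0) (k := 0) (by simp [add_eq_right.1 h])).1 (by decide)

/-- Reduction modulo two of the last coordinate, a homomorphism from `C₂ ⊕ C₂ ⊕ C₂ₙ` onto an
elementary abelian group whose kernel is cyclic of order `n`. -/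
def reduction (n : ℕ) : ZMod 2 × ZMod 2 × ZMod (2 * n) →+ ZMod 2 × ZMod 2 × ZMod 2 :=
  (AddMonoidHom.id (ZMod 2)).prodMap ((AddMonoidHom.id (ZMod 2)).prodMap
    (ZMod.castHom (dvd_mul_right 2 n) (ZMod 2)).toAddMonoidHom)

theorem reduction_apply (x y : ZMod 2) (z : ZMod (2 * n)) :
    reduction n (x, y, z) = (x, y, ZMod.castHom (dvd_mul_right 2 n) (ZMod 2) z) := rfl

theorem addOrderOf_zero_zero_two (hn : n ≠ 0) :
    addOrderOf ((0, 0, 2) : ZMod 2 × ZMod 2 × ZMod (2 * n)) = n := by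
  have htwo : addOrderOf ((2 : ℕ) : ZMod (2 * n)) = n := by
    rw [ZMod.addOrderOf_coe _ (by omega), Nat.gcd_mul_right_left, Nat.mul_div_cancel_left n two_pos]
  rw [Nat.cast_ofNat] at htwo
  simp [Prod.addOrderOf_mk, htwo]

theorem ker_reduction [NeZero n] :
    (reduction n).ker = AddSubgroup.zmultiples (0, 0, 2) := by
  refine le_antisymm ?_ ?_
  · rintro ⟨x, y, z⟩ h
    rw [AddMonoidHom.mem_ker, reduction_apply, Prod.mk_eq_zero, Prod.mk_eq_zero] at h
    obtain ⟨rfl, rfl, hz⟩ := h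
    obtain ⟨k, rfl⟩ := ZMod.natCast_zmod_surjective z
    rw [map_natCast, ZMod.natCast_eq_zero_iff] at hz
    obtain ⟨j, rfl⟩ := hz
    exact AddSubgroup.mem_zmultiples_iff.2 ⟨j, by simp [mul_comm]⟩
  · rw [AddSubgroup.zmultiples_le, AddMonoidHom.mem_ker, reduction_apply, map_ofNat]
    rfl

theorem exponent_eq (e : G ≃+ ZMod 2 × ZMod 2 × ZMod (2 * n)) :
    AddMonoid.exponent G = 2 * n := by
  have hlcm : lcm 2 (2 * n) = 2 * n := Nat.lcm_eq_right (dvd_mul_right 2 n)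
  rw [AddMonoid.exponent_eq_of_addEquiv e, AddMonoid.exponent_prod, AddMonoid.exponent_prod,
    ZMod.exponent, ZMod.exponent, hlcm, hlcm]

theorem exists_reduction (e : G ≃+ ZMod 2 × ZMod 2 × ZMod (2 * n)) (hn : n ≠ 0) :
    ∃ π : G →+ ZMod 2 × ZMod 2 × ZMod 2, Nat.card π.ker = n ∧ IsAddCyclic π.ker ∧
      ∃ f₁ f₂ f₃ : G, IsBasis n f₁ f₂ f₃ := by
  have : NeZero n := ⟨hn⟩
  have hgen : addOrderOf (e.symm (0, 0, 2)) = n :=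
    (e.symm.addOrderOf_eq _).trans (addOrderOf_zero_zero_two hn)
  let π : G →+ ZMod 2 × ZMod 2 × ZMod 2 := (reduction n).comp e.toAddMonoidHom
  have hπ (x) : π (e.symm x) = reduction n x := congrArg (reduction n) (e.apply_symm_apply x)
  have hker : π.ker = AddSubgroup.zmultiples (e.symm (0, 0, 2)) := by
    ext g
    have hmem : g ∈ π.ker ↔ e g ∈ (reduction n).ker := Iff.rfl
    rw [hmem, ker_reduction, AddSubgroup.mem_zmultiples_iff, AddSubgroup.mem_zmultiples_iff]
    simp only [← map_zsmul, AddEquiv.symm_apply_eq]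
  have hcard : Nat.card π.ker = n := by rw [hker, Nat.card_zmultiples, hgen]
  have : Finite π.ker := Nat.finite_of_card_ne_zero (hcard ▸ hn)
  have hind : IndependentModTwo π (e.symm (1, 0, 0)) (e.symm (0, 1, 0)) (e.symm (0, 0, 1)) := by
    intro j₁ j₂ j₃ hj
    simpa [hπ, reduction_apply, ZMod.intCast_zmod_eq_zero_iff_dvd, even_iff_two_dvd] using hj
  have htwo (x y z) : 2 • e.symm (x, y, z) = e.symm (0, 0, 2 * z) := by
    rw [← map_nsmul]
    simp [two_mul, ZModModule.add_self]
  have hbasis := hind.isBasis rfl (by simp [htwo]) (by simp [htwo])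
    (by rw [htwo, mul_one, hgen, hcard])
  exact ⟨π, hcard, hker ▸ inferInstance, _, _, _, hcard ▸ hbasis⟩

section Characterization

variable {V : Type*} [AddCommGroup V] [Module (ZMod 2) V] {π : G →+ V}

theorem two_mul_card_ker_nsmul (π : G →+ V) (g : G) : (2 * Nat.card π.ker) • g = 0 := by
  rw [mul_nsmul]
  exact congrArg Subtype.val
    (card_nsmul_eq_zero' (x := (⟨2 • g, two_nsmul_mem_ker π g⟩ : π.ker)))

theorem avoidsSum_iff_exists_basis [Fintype V] [Finite π.ker] [IsAddCyclic π.ker]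
    (hV : Fintype.card V = 8) (hπ : 2 ≤ Nat.card π.ker) (hS : S.card = 4 * Nat.card π.ker + 2) :
    AvoidsSum (2 * Nat.card π.ker) 0 S ↔
      ∃ f₁ f₂ f₃ f : G, IsBasis (Nat.card π.ker) f₁ f₂ f₃ ∧
        (FormS1 (Nat.card π.ker) f₁ f₂ f₃ (translate (-f) S) ∨
          FormS2 (Nat.card π.ker) f₁ f₂ f₃ (translate (-f) S) ∨
          FormS3 (Nat.card π.ker) f₁ f₂ f₃ (translate (-f) S)) := by
  constructor
  · intro h
    obtain ⟨g, f, e₁, e₂, α, α', β, β', γ, γ', hline⟩ := h.exists_lineForm hV hπ hS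
    obtain ⟨f₁, f₂, f₃, hbasis, hform⟩ := hline.exists_basis hV hπ
    exact ⟨f₁, f₂, f₃, g, hbasis, hform⟩
  · rintro ⟨f₁, f₂, f₃, f, hbasis, hform⟩
    have havoid : AvoidsSum (2 * Nat.card π.ker) 0 (translate (-f) S) := by
      rcases hform with h | h | h
      · exact h.avoidsSum hbasis
      · exact h.avoidsSum hbasis
      · exact h.avoidsSum (two_pos.trans_le hπ) hbasis
    rw [← translate_neg_translate (-f) S]
    exact havoid.translate (two_mul_card_ker_nsmul π (- -f))

end Characterization

end Main

end EGZ

theorem theorem5p1 {G : Type*} [AddCommGroup G] (n : ℕ) (hn : 2 ≤ n)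
    (hG : Nonempty (G ≃+ ZMod 2 × ZMod 2 × ZMod (2 * n))) :
    EGZ.egzConstant G = ((4 * n + 3 : ℕ) : ℕ∞) ∧
    ∀ S : Multiset G, S.card = 4 * n + 2 →
      ((0 : G) ∉ EGZ.subsums {AddMonoid.exponent G} S ↔
        ∃ f₁ f₂ f₃ f : G, EGZ.IsBasis n f₁ f₂ f₃ ∧
          (EGZ.FormS1 n f₁ f₂ f₃ (EGZ.translate (-f) S) ∨
            EGZ.FormS2 n f₁ f₂ f₃ (EGZ.translate (-f) S) ∨
            EGZ.FormS3 n f₁ f₂ f₃ (EGZ.translate (-f) S))) := by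
  obtain ⟨e⟩ := hG
  have hexp := EGZ.exponent_eq e
  obtain ⟨π, rfl, hcyclic, f₁, f₂, f₃, hbasis⟩ := EGZ.exists_reduction e (by omega)
  have : Finite π.ker := Nat.finite_of_card_ne_zero (by omega)
  have hV : Fintype.card (ZMod 2 × ZMod 2 × ZMod 2) = 8 := rfl
  constructor
  · obtain ⟨T, hT, hform⟩ := hbasis.exists_formS3 (by omega)
    refine EGZ.egzConstant_eq_succ (by omega) ?_ ?_ hT <;> rw [hexp]
    · exact fun T hT => hT.card_le hV hn
    · exact hform.avoidsSum (by omega) hbasis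
  · intro S hS
    rw [hexp, EGZ.zero_notMem_subsums_iff (by omega), EGZ.avoidsSum_iff_exists_basis hV hn hS]
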